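/- Let $\Phi\in\mathbb{R}$. On $\ell^2(\mathbb{Z}^2;\mathbb{C})$ let $(\tau_0u)_{\gamma_1,\gamma_2}=u_{\gamma_1-1,\gamma_2}$ and $(\tau_1u)_{\gamma_1,\gamma_2}=e^{-i\Phi\gamma_1}u_{\gamma_1,\gamma_2-1}$, and let $$Q_\Lambda(\Phi)=\frac13\begin{pmatrix}0&1+\tau_0+\tau_1\\(1+\tau_0+\tau_1)^*&0\end{pmatrix}$$ act on $\ell^2(\mathbb{Z}^2;\mathbb{C}^2)=\ell^2(\mathbb{Z}^2)\oplus\ell^2(\mathbb{Z}^2)$. For $\theta\in\mathbb{T}_1=\mathbb{R}/\mathbb{Z}$ let $H_{\Phi,\theta}$ be the Jacobi matrix on $\ell^2(\mathbb{Z})$ given by $$(H_{\Phi,\theta}u)_m=c\left(\theta+m\tfrac{\Phi}{2\pi}\right)u_{m+1}+\overline{c\left(\theta+(m-1)\tfrac{\Phi}{2\pi}\right)}\,u_{m-1}+v\left(\theta+m\tfrac{\Phi}{2\pi}\right)u_m,$$ where $c(\theta)=1+e^{-2\pi i\theta}$ and $v(\theta)=2\cos 2\pi\theta$. Put $\Sigma_\Phi=\bigcup_{\theta\in\mathbb{T}_1}\sigma(H_{\Phi,\theta})$.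 Then: 1. $\Sigma_\Phi\subset[-3,\infty)$ (so that the square roots below are real), and $$\sigma(Q_\Lambda(\Phi))=\left\{\pm\sqrt{\tfrac{E}{9}+\tfrac13}\;:\;E\in\Sigma_\Phi\right\}\cup\{0\}.$$ 2. $Q_\Lambda(\Phi)$ has no point spectrum, that is, no eigenvalues. -/

import Mathlib

open scoped ENNReal ComplexConjugate

namespace HexMagnetic

noncomputable section

/-- The Hilbert space `ℓ²(ι; ℂ)`. -/
abbrev Ell2 (ι : Type) : Type := lp (fun _ : ι => ℂ) 2

/-- A bounded weight times a relabelled square-summable sequence is square-summable. -/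
theorem weightedShift_aux {ι : Type} (σ : ι ≃ ι) (w : ι → ℂ) (C : ℝ) (hw : ∀ i, ‖w i‖ ≤ C)
    (u : Ell2 ι) :
    Summable (fun i => ‖w i * u (σ i)‖ ^ 2) ∧
      ∑' i, ‖w i * u (σ i)‖ ^ 2 ≤ (|C| * ‖u‖) ^ 2 := by
  have hu : HasSum (fun i => ‖u i‖ ^ 2) (‖u‖ ^ 2) := by
    have h := lp.hasSum_norm (p := 2) (by norm_num) u
    simpa using h
  have hs : HasSum (fun i => |C| ^ 2 * ‖u (σ i)‖ ^ 2) (|C| ^ 2 * ‖u‖ ^ 2) :=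
    ((Equiv.hasSum_iff σ).2 hu).mul_left _
  have hle : ∀ i, ‖w i * u (σ i)‖ ^ 2 ≤ |C| ^ 2 * ‖u (σ i)‖ ^ 2 := by
    intro i
    rw [norm_mul, mul_pow]
    have h1 : ‖w i‖ ≤ |C| := (hw i).trans (le_abs_self C)
    gcongr
  have hsum : Summable (fun i => ‖w i * u (σ i)‖ ^ 2) :=
    Summable.of_nonneg_of_le (fun i => by positivity) hle hs.summable
  refine ⟨hsum, ?_⟩
  calc ∑' i, ‖w i * u (σ i)‖ ^ 2 ≤ ∑' i, |C| ^ 2 * ‖u (σ i)‖ ^ 2 :=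
        hsum.tsum_le_tsum hle hs.summable
    _ = (|C| * ‖u‖) ^ 2 := by rw [hs.tsum_eq, mul_pow]

/-- For a bijection `σ` of `ι` and a bounded weight `w`, the bounded operator on `ℓ²(ι)` given by
`(weightedShift σ w u) i = w i * u (σ i)`. -/
def weightedShift {ι : Type} (σ : ι ≃ ι) (w : ι → ℂ) (C : ℝ) (hw : ∀ i, ‖w i‖ ≤ C) :
    Ell2 ι →L[ℂ] Ell2 ι :=
  LinearMap.mkContinuous
    { toFun := fun u => ⟨fun i => w i * u (σ i), by
        refine memℓp_gen ?_
        simpa using (weightedShift_aux σ w C hw u).1⟩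
      map_add' := fun u v => by
        ext i
        exact mul_add (w i) (u (σ i)) (v (σ i))
      map_smul' := fun a u => by
        ext i
        exact mul_left_comm (w i) a (u (σ i)) }
    |C| (fun u => by
      refine lp.norm_le_of_tsum_le (p := 2) (by norm_num) (by positivity) ?_
      simpa using (weightedShift_aux σ w C hw u).2)

theorem weightedShift_apply {ι : Type} (σ : ι ≃ ι) (w : ι → ℂ) (C : ℝ) (hw : ∀ i, ‖w i‖ ≤ C)
    (u : Ell2 ι) (i : ι) : weightedShift σ w C hw u i = w i * u (σ i) := rfl

/-- The bijection `(m, n) ↦ (m - 1, n)` of `ℤ²`. -/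
def shiftFst : ℤ × ℤ ≃ ℤ × ℤ := Equiv.prodCongr (Equiv.subRight 1) (Equiv.refl ℤ)

/-- The bijection `(m, n) ↦ (m, n - 1)` of `ℤ²`. -/
def shiftSnd : ℤ × ℤ ≃ ℤ × ℤ := Equiv.prodCongr (Equiv.refl ℤ) (Equiv.subRight 1)

/-- The magnetic phase `exp (-i Φ m)` at `(m, n)`. -/
def phase (Φ : ℝ) (γ : ℤ × ℤ) : ℂ := Complex.exp (-Complex.I * Φ * γ.1)

theorem norm_phase_le (Φ : ℝ) (γ : ℤ × ℤ) : ‖phase Φ γ‖ ≤ 1 := by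
  simp [phase, Complex.norm_exp]

/-- The translation `τ₀` on `ℓ²(ℤ²)`. -/
def tau0 : Ell2 (ℤ × ℤ) →L[ℂ] Ell2 (ℤ × ℤ) :=
  weightedShift shiftFst (fun _ => 1) 1 (fun _ => by simp)

/-- The magnetic translation `τ₁` on `ℓ²(ℤ²)`. -/
def tau1 (Φ : ℝ) : Ell2 (ℤ × ℤ) →L[ℂ] Ell2 (ℤ × ℤ) :=
  weightedShift shiftSnd (phase Φ) 1 (norm_phase_le Φ)

theorem tau0_apply (u : Ell2 (ℤ × ℤ)) (m n : ℤ) : tau0 u (m, n) = u (m - 1, n) := by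
  simp [tau0, weightedShift_apply, shiftFst]

theorem tau1_apply (Φ : ℝ) (u : Ell2 (ℤ × ℤ)) (m n : ℤ) :
    tau1 Φ u (m, n) = Complex.exp (-Complex.I * Φ * m) * u (m, n - 1) := by
  simp [tau1, weightedShift_apply, shiftSnd, phase]

/-- The block operator `(0, T; T*, 0)` on the Hilbert space direct sum `E ⊕ E`. -/
def offDiag {E : Type} [NormedAddCommGroup E] [InnerProductSpace ℂ E] [CompleteSpace E]
    (T : E →L[ℂ] E) : WithLp 2 (E × E) →L[ℂ] WithLp 2 (E × E) :=
  ((WithLp.prodContinuousLinearEquiv 2 ℂ E E).symm : E × E →L[ℂ] WithLp 2 (E × E)) ∘L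
    ((T ∘L ContinuousLinearMap.snd ℂ E E).prod
      (ContinuousLinearMap.adjoint T ∘L ContinuousLinearMap.fst ℂ E E)) ∘L
    ((WithLp.prodContinuousLinearEquiv 2 ℂ E E) : WithLp 2 (E × E) →L[ℂ] E × E)

theorem offDiag_apply {E : Type} [NormedAddCommGroup E] [InnerProductSpace ℂ E] [CompleteSpace E]
    (T : E →L[ℂ] E) (x y : E) :
    offDiag T (WithLp.toLp 2 (x, y)) = WithLp.toLp 2 (T y, ContinuousLinearMap.adjoint T x) := rfl

/-- The tight-binding operator `Q_Λ(Φ)` of the hexagonal lattice with magnetic flux `Φ`, on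
`ℓ²(ℤ²) ⊕ ℓ²(ℤ²) = ℓ²(ℤ²; ℂ²)`. -/
def Q (Φ : ℝ) : WithLp 2 (Ell2 (ℤ × ℤ) × Ell2 (ℤ × ℤ)) →L[ℂ]
    WithLp 2 (Ell2 (ℤ × ℤ) × Ell2 (ℤ × ℤ)) :=
  (1 / 3 : ℂ) • offDiag (1 + tau0 + tau1 Φ)

/-- `c(θ) = 1 + exp (-2πiθ)`. -/
def c (θ : ℝ) : ℂ := 1 + Complex.exp (-2 * Real.pi * Complex.I * θ)

/-- `v(θ) = 2 cos (2πθ)`. -/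
def v (θ : ℝ) : ℝ := 2 * Real.cos (2 * Real.pi * θ)

theorem norm_c_le (θ : ℝ) : ‖c θ‖ ≤ 2 := by
  refine (norm_add_le _ _).trans ?_
  have h : ‖Complex.exp (-2 * Real.pi * Complex.I * θ)‖ = 1 := by
    simp [Complex.norm_exp]
  rw [h]
  norm_num

theorem norm_v_le (θ : ℝ) : ‖(v θ : ℂ)‖ ≤ 2 := by
  rw [Complex.norm_real, Real.norm_eq_abs, v, abs_mul, abs_two]
  linarith [Real.abs_cos_le_one (2 * Real.pi * θ)]

/-- The quasi-periodic Jacobi matrix `H_{Φ,θ}` on `ℓ²(ℤ)`; see `H_apply`. -/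
def H (Φ θ : ℝ) : Ell2 ℤ →L[ℂ] Ell2 ℤ :=
  weightedShift (Equiv.addRight 1) (fun m : ℤ => c (θ + m * (Φ / (2 * Real.pi)))) 2
      (fun _ => norm_c_le _) +
    weightedShift (Equiv.subRight 1)
      (fun m : ℤ => conj (c (θ + ((m : ℝ) - 1) * (Φ / (2 * Real.pi))))) 2
      (fun _ => by rw [RCLike.norm_conj]; exact norm_c_le _) +
    weightedShift (Equiv.refl ℤ) (fun m : ℤ => ((v (θ + m * (Φ / (2 * Real.pi))) : ℝ) : ℂ)) 2
      (fun _ => norm_v_le _)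

theorem H_apply (Φ θ : ℝ) (u : Ell2 ℤ) (m : ℤ) :
    H Φ θ u m = c (θ + m * (Φ / (2 * Real.pi))) * u (m + 1) +
      conj (c (θ + ((m : ℝ) - 1) * (Φ / (2 * Real.pi)))) * u (m - 1) +
      ((v (θ + m * (Φ / (2 * Real.pi))) : ℝ) : ℂ) * u m := rfl

/-- `H_{Φ,θ}` depends on `θ` only modulo `1`. -/
theorem H_periodic (Φ θ : ℝ) : H Φ (θ + 1) = H Φ θ := by
  have hc : ∀ x : ℝ, c (x + 1) = c x := by
    intro x
    have h : (-2 * Real.pi * Complex.I * ((x + 1 : ℝ) : ℂ)) =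
        -2 * Real.pi * Complex.I * x - 2 * Real.pi * Complex.I := by
      push_cast
      ring
    rw [c, c, h, Complex.exp_periodic.sub_eq]
  have hv : ∀ x : ℝ, v (x + 1) = v x := by
    intro x
    rw [v, v, mul_add, mul_one, Real.cos_add_two_pi]
  ext u m
  simp only [H_apply, add_right_comm θ 1, hc, hv]

/-- The union `Σ_Φ` over `θ` of the (complex) spectra of `H_{Φ,θ}`. -/
def unionSpectrum (Φ : ℝ) : Set ℂ := ⋃ θ : ℝ, spectrum ℂ (H Φ θ)

end

end HexMagnetic

open scoped ENNReal ComplexConjugate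

namespace HexMagnetic


/-! Write `T` for `hop Φ`, so that `Q Φ` is a third of the block operator with corners `T` and `T*`.
All spectral questions concern self-adjoint operators, for which a real point is in the spectrum
exactly when the shifted operator is not bounded below.

Away from `0`, eliminating one component shows that `r` is in the spectrum of the block operator iff
`r ^ 2` is in that of `T T*` (`isBoundedBelow_offDiag_sub_iff`). The phase depends only on the first
coordinate, so a Fourier transform in the second one decomposes `T T*` into the fibres `T_θ T_θ*`,
which equal `H Φ θ + 3` (`H_eq_fibreHop_mul_sub`). Lower bounds pass from the fibres to `T T*` by
Parseval and back by truncated plane waves, so the spectrum of `T T*` is `3` plus the union of the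
fibre spectra (`mem_unionSpectrum_iff`).

The point `0` needs its own argument (`not_forall_fibres_bounded_below`). If it were not in the
spectrum, all the bidiagonal `T_θ` would be invertible with uniformly bounded inverses. One matrix
entry of the inverse is an idempotent continuous in `θ`, hence constant, and it is `1` at `θ = 1/2`.
The entries to its left are then polynomials in `exp (-2πiθ)` with unimodular constant term. Each
has mean square at least `1` in `θ`, which contradicts square-summability.

Eigenvalues are excluded by comparing area with perimeter (`starProjection_site_eq_zero`). Magnetic
translations commuting with `T` and `T*` keep the projections of basis vectors onto an eigenspace
from shrinking across a box. An eigenvector on an `N × N` box is determined by `O(N)` boundary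
values, so these projections have total square norm `O(N)` over about `N ^ 2` sites. -/

theorem norm_fst_le {E : Type} [NormedAddCommGroup E] (x y : E) : ‖x‖ ≤ ‖WithLp.toLp 2 (x, y)‖ := by
  rw [WithLp.prod_norm_eq_of_L2]
  exact Real.le_sqrt_of_sq_le (by simp)

theorem norm_snd_le {E : Type} [NormedAddCommGroup E] (x y : E) : ‖y‖ ≤ ‖WithLp.toLp 2 (x, y)‖ := by
  rw [WithLp.prod_norm_eq_of_L2]
  exact Real.le_sqrt_of_sq_le (by simp)

theorem norm_toLp_le {E : Type} [NormedAddCommGroup E] (x y : E) : ‖WithLp.toLp 2 (x, y)‖ ≤ ‖x‖ + ‖y‖ := by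
  rw [WithLp.prod_norm_eq_of_L2]
  refine Real.sqrt_le_iff.2 ⟨by positivity, ?_⟩
  simp only [WithLp.toLp_fst, WithLp.toLp_snd]
  nlinarith [norm_nonneg x, norm_nonneg y]

/-! ### Lower bounds, self-adjoint spectra and off-diagonal block operators -/

section BoundedBelow

variable {E : Type} [NormedAddCommGroup E] [InnerProductSpace ℂ E]

/-- The operator `A` is bounded below: `δ ‖u‖ ≤ ‖A u‖` for some `δ > 0`. -/
def IsBoundedBelow (A : E →L[ℂ] E) : Prop := ∃ δ : ℝ, 0 < δ ∧ ∀ u, δ * ‖u‖ ≤ ‖A u‖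

theorem isBoundedBelow_of_isUnit {A : E →L[ℂ] E} (hA : IsUnit A) : IsBoundedBelow A := by
  obtain ⟨a, rfl⟩ := hA
  have hpos : 0 < ‖((a⁻¹ : (E →L[ℂ] E)ˣ) : E →L[ℂ] E)‖ + 1 := by positivity
  refine ⟨(‖((a⁻¹ : (E →L[ℂ] E)ˣ) : E →L[ℂ] E)‖ + 1)⁻¹, inv_pos.2 hpos, fun u => ?_⟩
  rw [inv_mul_le_iff₀ hpos]
  have h : ((a⁻¹ : (E →L[ℂ] E)ˣ) : E →L[ℂ] E) ((a : E →L[ℂ] E) u) = u := by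
    rw [← mul_apply_eq_comp, Units.inv_mul, one_apply_eq_self]
  calc ‖u‖ = ‖((a⁻¹ : (E →L[ℂ] E)ˣ) : E →L[ℂ] E) ((a : E →L[ℂ] E) u)‖ := by rw [h]
    _ ≤ _ := ContinuousLinearMap.le_opNorm _ _
    _ ≤ _ := by gcongr; linarith

theorem IsBoundedBelow.injective {A : E →L[ℂ] E} (h : IsBoundedBelow A) :
    ∀ u, A u = 0 → u = 0 := by
  obtain ⟨δ, hδ, h⟩ := h
  intro u hu
  have := h u
  rw [hu, norm_zero] at this
  have h2 : ‖u‖ ≤ 0 := by nlinarith [norm_nonneg u]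
  simpa using h2

theorem IsBoundedBelow.mul {A B : E →L[ℂ] E} (hA : IsBoundedBelow A) (hB : IsBoundedBelow B) :
    IsBoundedBelow (A * B) := by
  obtain ⟨a, ha, hA⟩ := hA
  obtain ⟨b, hb, hB⟩ := hB
  refine ⟨a * b, by positivity, fun u => ?_⟩
  calc a * b * ‖u‖ = a * (b * ‖u‖) := by ring
    _ ≤ a * ‖B u‖ := by gcongr; exact hB u
    _ ≤ _ := hA _

theorem isBoundedBelow_smul_iff {A : E →L[ℂ] E} {z : ℂ} (hz : z ≠ 0) :
    IsBoundedBelow (z • A) ↔ IsBoundedBelow A := by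
  have key : ∀ (B : E →L[ℂ] E) (w : ℂ), w ≠ 0 → IsBoundedBelow B → IsBoundedBelow (w • B) := by
    rintro B w hw ⟨δ, hδ, h⟩
    refine ⟨‖w‖ * δ, mul_pos (norm_pos_iff.2 hw) hδ, fun u => ?_⟩
    rw [smul_apply, norm_smul, mul_assoc]
    gcongr
    exact h u
  refine ⟨fun h => ?_, key A z hz⟩
  simpa [smul_smul, hz] using key _ z⁻¹ (inv_ne_zero hz) h

theorem isBoundedBelow_sub_zero_smul {A : E →L[ℂ] E} :
    IsBoundedBelow (A - ((0 : ℝ) : ℂ) • 1) ↔ IsBoundedBelow A := by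
  rw [Complex.ofReal_zero, zero_smul, sub_zero]

variable [CompleteSpace E]

/-- The lower bound gives injectivity and closed range; the orthogonal complement of the range is
the kernel of the adjoint, which is `A` itself. -/
theorem isUnit_of_isBoundedBelow {A : E →L[ℂ] E} (hA : IsSelfAdjoint A)
    (h : IsBoundedBelow A) : IsUnit A := by
  rw [ContinuousLinearMap.isUnit_iff_bijective,
    ContinuousLinearMap.bijective_iff_dense_range_and_antilipschitz]
  refine ⟨?_, ?_⟩
  · rw [Submodule.topologicalClosure_eq_top_iff, ContinuousLinearMap.orthogonal_range,
      LinearMap.ker_eq_bot']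
    have : ContinuousLinearMap.adjoint A = A := hA
    rw [this]
    exact h.injective
  · obtain ⟨δ, hδ, h⟩ := h
    refine ⟨⟨δ⁻¹, by positivity⟩, AddMonoidHomClass.antilipschitz_of_bound _ fun u => ?_⟩
    exact (le_inv_mul_iff₀ hδ).2 (h u)

/-- The real point `r` lies in the spectrum of the self-adjoint `A` iff `A - r` is not bounded
below. -/
theorem mem_spectrum_iff_not_isBoundedBelow {A : E →L[ℂ] E} (hA : IsSelfAdjoint A) (r : ℝ) :
    (r : ℂ) ∈ spectrum ℂ A ↔ ¬ IsBoundedBelow (A - (r : ℂ) • 1) := by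
  have hr : IsSelfAdjoint (A - (r : ℂ) • 1) :=
    hA.sub (IsSelfAdjoint.smul (by simp [isSelfAdjoint_iff]) (.one _))
  rw [spectrum.mem_iff, not_iff_not, Algebra.algebraMap_eq_smul_one, ← IsUnit.neg_iff, neg_sub]
  exact ⟨isBoundedBelow_of_isUnit, isUnit_of_isBoundedBelow hr⟩

theorem isSelfAdjoint_offDiag (T : E →L[ℂ] E) : IsSelfAdjoint (offDiag T) := by
  rw [ContinuousLinearMap.isSelfAdjoint_iff_isSymmetric]
  rintro ⟨x, y⟩ ⟨x', y'⟩
  simp only [ContinuousLinearMap.coe_coe, offDiag_apply, WithLp.prod_inner_apply]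
  rw [ContinuousLinearMap.adjoint_inner_left, ← ContinuousLinearMap.adjoint_inner_right T, add_comm]

theorem IsBoundedBelow.of_offDiag {T : E →L[ℂ] E} (h : IsBoundedBelow (offDiag T)) :
    IsBoundedBelow T ∧ IsBoundedBelow (ContinuousLinearMap.adjoint T) := by
  obtain ⟨δ, hδ, h⟩ := h
  refine ⟨⟨δ, hδ, fun u => ?_⟩, ⟨δ, hδ, fun u => ?_⟩⟩
  · simpa [offDiag_apply] using h (WithLp.toLp 2 (0, u))
  · simpa [offDiag_apply] using h (WithLp.toLp 2 (u, 0))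

theorem isBoundedBelow_offDiag_sub_iff (T : E →L[ℂ] E) {r : ℝ} (hr : r ≠ 0) :
    IsBoundedBelow (offDiag T - (r : ℂ) • 1) ↔
      IsBoundedBelow (T * ContinuousLinearMap.adjoint T - ((r ^ 2 : ℝ) : ℂ) • 1) := by
  have hrC : (r : ℂ) ≠ 0 := by exact_mod_cast hr
  have hr0 : 0 < |r| := abs_pos.2 hr
  constructor
  · rintro ⟨δ, hδ, h⟩
    refine ⟨|r| * δ, by positivity, fun x => ?_⟩
    set S := ContinuousLinearMap.adjoint T with hS
    -- The second component is chosen so that the second row of the block operator minus `r`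
    -- vanishes.
    have h1 := h (WithLp.toLp 2 (x, (r : ℂ)⁻¹ • S x))
    have h2 : (offDiag T - (r : ℂ) • 1) (WithLp.toLp 2 (x, (r : ℂ)⁻¹ • S x)) =
        WithLp.toLp 2 ((r : ℂ)⁻¹ • (T * S - ((r ^ 2 : ℝ) : ℂ) • 1) x, 0) := by
      rw [sub_apply, offDiag_apply, smul_apply,
        one_apply_eq_self, ← WithLp.toLp_smul, ← WithLp.toLp_sub]
      congr 1
      ext1
      · simp [smul_sub, smul_smul, pow_two, hrC]
      · simp [smul_smul, hrC, ← hS]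
    rw [h2] at h1
    have h3 := norm_fst_le x ((r : ℂ)⁻¹ • S x)
    have h4 := norm_toLp_le ((r : ℂ)⁻¹ • (T * S - ((r ^ 2 : ℝ) : ℂ) • 1) x) 0
    rw [norm_zero, add_zero, norm_smul, norm_inv, Complex.norm_real, Real.norm_eq_abs] at h4
    have h5 : δ * ‖x‖ ≤ |r|⁻¹ * ‖(T * S - ((r ^ 2 : ℝ) : ℂ) • 1) x‖ :=
      (mul_le_mul_of_nonneg_left h3 hδ.le).trans (h1.trans h4)
    rw [le_inv_mul_iff₀ hr0] at h5
    linarith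
  · rintro ⟨δ, hδ, h⟩
    set S := ContinuousLinearMap.adjoint T with hS
    have hM : 0 ≤ ‖T‖ := norm_nonneg T
    have hN : 0 ≤ ‖S‖ := norm_nonneg S
    set C := δ⁻¹ * (‖T‖ + |r|) with hC
    have hC0 : 0 ≤ C := by positivity
    set K := C + |r|⁻¹ * (‖S‖ * C + 1) with hK
    have hK0 : 0 < K := by positivity
    refine ⟨K⁻¹, by positivity, ?_⟩
    rintro ⟨x, y⟩
    have h2 : (offDiag T - (r : ℂ) • 1) (WithLp.toLp 2 (x, y)) =
        WithLp.toLp 2 (T y - (r : ℂ) • x, S x - (r : ℂ) • y) := by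
      rw [sub_apply, offDiag_apply, smul_apply,
        one_apply_eq_self, ← WithLp.toLp_smul, ← WithLp.toLp_sub]
      rfl
    rw [h2]
    set f := T y - (r : ℂ) • x with hf
    set g := S x - (r : ℂ) • y with hg
    set n := ‖WithLp.toLp 2 (f, g)‖ with hn
    have hfn : ‖f‖ ≤ n := norm_fst_le f g
    have hgn : ‖g‖ ≤ n := norm_snd_le f g
    -- Eliminating `y` between the two rows bounds `x` by `f` and `g`; the second row then bounds
    -- `y`.
    have hx : (T * S - ((r ^ 2 : ℝ) : ℂ) • 1) x = T g + (r : ℂ) • f := by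
      simp [hf, hg, smul_sub, smul_smul, pow_two, -Complex.coe_smul, -Complex.real_smul]
    have h3 : ‖x‖ ≤ C * n := by
      rw [hC, mul_assoc, le_inv_mul_iff₀ hδ]
      calc δ * ‖x‖ ≤ ‖T g + (r : ℂ) • f‖ := hx ▸ h x
        _ ≤ ‖T‖ * ‖g‖ + |r| * ‖f‖ := by
          refine (norm_add_le _ _).trans (add_le_add (T.le_opNorm g) ?_)
          rw [norm_smul, Complex.norm_real, Real.norm_eq_abs]
        _ ≤ ‖T‖ * n + |r| * n := by gcongr
        _ = _ := by ring
    have h4 : ‖y‖ ≤ |r|⁻¹ * (‖S‖ * C + 1) * n := by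
      rw [mul_assoc, le_inv_mul_iff₀ hr0]
      calc |r| * ‖y‖ = ‖S x - g‖ := by
            rw [hg, sub_sub_cancel, norm_smul, Complex.norm_real, Real.norm_eq_abs]
        _ ≤ ‖S‖ * ‖x‖ + ‖g‖ := (norm_sub_le _ _).trans (add_le_add_left (S.le_opNorm x) _)
        _ ≤ ‖S‖ * (C * n) + n := by gcongr
        _ = _ := by ring
    rw [inv_mul_le_iff₀ hK0]
    calc ‖WithLp.toLp 2 (x, y)‖ ≤ ‖x‖ + ‖y‖ := norm_toLp_le x y
      _ ≤ C * n + |r|⁻¹ * (‖S‖ * C + 1) * n := add_le_add h3 h4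
      _ = K * n := by rw [hK]; ring

/-- A negative number is not in the spectrum of `T T*`. -/
theorem isBoundedBelow_mul_adjoint_sub (T : E →L[ℂ] E) {r : ℝ} (hr : r < 0) :
    IsBoundedBelow (T * ContinuousLinearMap.adjoint T - (r : ℂ) • 1) := by
  refine ⟨-r, by linarith, fun u => ?_⟩
  by_cases hu : u = 0
  · simp [hu]
  have hu0 : 0 < ‖u‖ := norm_pos_iff.2 hu
  refine le_of_mul_le_mul_right ?_ hu0
  set S := ContinuousLinearMap.adjoint T with hS
  calc -r * ‖u‖ * ‖u‖ ≤ ‖S u‖ ^ 2 + -r * ‖u‖ ^ 2 := by nlinarith [sq_nonneg ‖S u‖]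
    _ = (inner ℂ ((T * S - (r : ℂ) • 1) u) u).re := by
      have h1 : inner ℂ (T (S u)) u = ((‖S u‖ ^ 2 : ℝ) : ℂ) := by
        rw [← ContinuousLinearMap.adjoint_inner_right, ← hS, inner_self_eq_norm_sq_to_K]
        push_cast; rfl
      have h2 : inner ℂ ((r : ℂ) • u) u = ((r * ‖u‖ ^ 2 : ℝ) : ℂ) := by
        rw [inner_smul_left, inner_self_eq_norm_sq_to_K]
        simp
      simp only [sub_apply, mul_apply_eq_comp,
        smul_apply, one_apply_eq_self]
      rw [inner_sub_left, h1, h2, ← Complex.ofReal_sub, Complex.ofReal_re]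
      ring
    _ ≤ ‖(T * S - (r : ℂ) • 1) u‖ * ‖u‖ := (Complex.re_le_norm _).trans (norm_inner_le_norm _ _)

end BoundedBelow


/-! ### Fourier series and tridiagonal translation-invariant operators -/

/-- The character `x ↦ exp (2πix)` of `ℝ / ℤ`. -/
noncomputable def expChar (x : ℝ) : ℂ := Complex.exp (2 * Real.pi * Complex.I * x)

theorem expChar_add (x y : ℝ) : expChar (x + y) = expChar x * expChar y := by
  rw [expChar, expChar, expChar, ← Complex.exp_add]
  push_cast
  ring_nf

@[simp] theorem expChar_zero : expChar 0 = 1 := by simp [expChar]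

@[simp] theorem norm_expChar (x : ℝ) : ‖expChar x‖ = 1 := by
  simp [expChar, Complex.norm_exp]

theorem conj_expChar (x : ℝ) : conj (expChar x) = expChar (-x) := by
  rw [expChar, expChar, ← Complex.exp_conj]
  congr 1
  simp [map_ofNat]

theorem expChar_mul_neg (x : ℝ) : expChar x * expChar (-x) = 1 := by
  rw [← expChar_add, add_neg_cancel, expChar_zero]

@[fun_prop] theorem continuous_expChar : Continuous expChar := by
  unfold expChar
  fun_prop

theorem integral_expChar_int_mul (k : ℤ) :
    ∫ θ in (0 : ℝ)..1, expChar (k * θ) = if k = 0 then 1 else 0 := by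
  split_ifs with hk
  · simp [hk]
  · have hc : 2 * Real.pi * Complex.I * k ≠ 0 := by
      simp [Real.pi_ne_zero, hk]
    have h := integral_exp_mul_complex (a := 0) (b := 1) hc
    have h1 : Complex.exp (2 * Real.pi * Complex.I * k) = 1 :=
      Complex.exp_eq_one_iff.2 ⟨k, by ring⟩
    have h2 : ∀ θ : ℝ, expChar (k * θ) = Complex.exp (2 * Real.pi * Complex.I * k * θ) := by
      intro θ
      rw [expChar]
      push_cast
      ring_nf
    simp_rw [h2]
    rw [h]
    simp [h1]

section Transfer

variable {X Y : Type} [NormedAddCommGroup X] [InnerProductSpace ℂ X]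
  [NormedAddCommGroup Y] [InnerProductSpace ℂ Y]

/-- Parseval's identity for trigonometric polynomials with vector coefficients. -/
theorem integral_norm_sq_trigPoly (s : Finset ℤ) (a : ℤ → X) :
    ∫ θ in (0 : ℝ)..1, ‖∑ n ∈ s, expChar (-(n * θ)) • a n‖ ^ 2 = ∑ n ∈ s, ‖a n‖ ^ 2 := by
  have h1 : ∀ θ : ℝ, ((‖∑ n ∈ s, expChar (-(n * θ)) • a n‖ ^ 2 : ℝ) : ℂ) =
      ∑ n ∈ s, ∑ k ∈ s, expChar (((n - k : ℤ) : ℝ) * θ) * inner ℂ (a n) (a k) := by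
    intro θ
    have h := inner_self_eq_norm_sq_to_K (𝕜 := ℂ) (∑ n ∈ s, expChar (-(n * θ)) • a n)
    have h' : ((‖∑ n ∈ s, expChar (-(n * θ)) • a n‖ ^ 2 : ℝ) : ℂ) =
      inner ℂ (∑ n ∈ s, expChar (-(n * θ)) • a n) (∑ n ∈ s, expChar (-(n * θ)) • a n) := by
      rw [h]; push_cast; rfl
    rw [h', sum_inner]
    refine Finset.sum_congr rfl fun n _ => ?_
    rw [inner_sum]
    refine Finset.sum_congr rfl fun k _ => ?_
    rw [inner_smul_left, inner_smul_right, conj_expChar, ← mul_assoc, ← expChar_add]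
    congr 2
    push_cast
    ring
  have h2 : ((∫ θ in (0 : ℝ)..1, ‖∑ n ∈ s, expChar (-(n * θ)) • a n‖ ^ 2 : ℝ) : ℂ) =
      ((∑ n ∈ s, ‖a n‖ ^ 2 : ℝ) : ℂ) := by
    rw [← intervalIntegral.integral_ofReal]
    simp_rw [h1]
    rw [intervalIntegral.integral_finsetSum
      fun n _ => Continuous.intervalIntegrable (by fun_prop) _ _]
    rw [Complex.ofReal_sum]
    refine Finset.sum_congr rfl fun n hn => ?_
    rw [intervalIntegral.integral_finsetSum
      fun n _ => Continuous.intervalIntegrable (by fun_prop) _ _]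
    simp_rw [intervalIntegral.integral_mul_const, integral_expChar_int_mul, sub_eq_zero, ite_mul,
      zero_mul, one_mul]
    rw [Finset.sum_ite_eq, if_pos hn, inner_self_eq_norm_sq_to_K]
    push_cast; rfl
  exact_mod_cast h2

/-- The linear map `∑ aₙ ↦ ∑ V n aₙ`. -/
noncomputable def assemble (V : ℤ → X →ₗᵢ[ℂ] Y) : (ℤ →₀ X) →ₗ[ℂ] Y :=
  Finsupp.lsum ℂ fun n => (V n).toLinearMap

/-- The trigonometric polynomial `∑ exp (-2πinθ) aₙ`. -/
noncomputable def trigPoly (θ : ℝ) : (ℤ →₀ X) →ₗ[ℂ] X :=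
  Finsupp.lsum ℂ fun n : ℤ => expChar (-(n * θ)) • LinearMap.id

theorem trigPoly_apply (θ : ℝ) (f : ℤ →₀ X) :
    trigPoly θ f = ∑ n ∈ f.support, expChar (-(n * θ)) • f n := by
  simp [trigPoly, Finsupp.lsum_apply, Finsupp.sum]

theorem norm_sq_assemble {V : ℤ → X →ₗᵢ[ℂ] Y} (hV : OrthogonalFamily ℂ (fun _ : ℤ => X) V)
    (f : ℤ →₀ X) : ‖assemble V f‖ ^ 2 = ∫ θ in (0 : ℝ)..1, ‖trigPoly θ f‖ ^ 2 := by
  simp_rw [trigPoly_apply]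
  rw [integral_norm_sq_trigPoly, ← hV.norm_sum]
  simp [assemble, Finsupp.lsum_apply, Finsupp.sum]

/-- The fibre at `θ` of the tridiagonal translation-invariant operator with blocks `bm`, `b0`,
`bp`. -/
noncomputable def fibre (bm b0 bp : X →L[ℂ] X) (θ : ℝ) : X →L[ℂ] X :=
  expChar θ • bm + b0 + expChar (-θ) • bp

/-- The action of a tridiagonal translation-invariant operator on finite sequences. -/
noncomputable def laurent (bm b0 bp : X →L[ℂ] X) : (ℤ →₀ X) →ₗ[ℂ] (ℤ →₀ X) :=
  Finsupp.lsum ℂ fun n : ℤ => Finsupp.lsingle (n - 1) ∘ₗ bm.toLinearMap +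
    Finsupp.lsingle n ∘ₗ b0.toLinearMap + Finsupp.lsingle (n + 1) ∘ₗ bp.toLinearMap

/-- Moving a block from `n` to `n - 1` multiplies its character `exp (-2πinθ)` by `exp (2πiθ)`, and
moving it to `n + 1` by the inverse; these are the coefficients in `fibre`. -/
theorem trigPoly_laurent (bm b0 bp : X →L[ℂ] X) (θ : ℝ) (f : ℤ →₀ X) :
    trigPoly θ (laurent bm b0 bp f) = fibre bm b0 bp θ (trigPoly θ f) := by
  have h : trigPoly θ ∘ₗ laurent bm b0 bp = (fibre bm b0 bp θ).toLinearMap ∘ₗ trigPoly θ := by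
    refine Finsupp.lhom_ext fun n a => ?_
    have h1 : expChar (-(((n - 1 : ℤ) : ℝ) * θ)) = expChar (-(n * θ)) * expChar θ := by
      rw [← expChar_add]; push_cast; ring_nf
    have h2 : expChar (-(((n + 1 : ℤ) : ℝ) * θ)) = expChar (-(n * θ)) * expChar (-θ) := by
      rw [← expChar_add]; push_cast; ring_nf
    simp only [trigPoly, laurent, fibre, LinearMap.comp_apply, Finsupp.lsum_single, map_add,
      LinearMap.add_apply, Finsupp.lsingle_apply, LinearMap.smul_apply, LinearMap.id_apply, h1, h2,
      ContinuousLinearMap.coe_coe, map_smul, add_apply, smul_apply, smul_add, smul_smul]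
  exact LinearMap.congr_fun h f

theorem assemble_laurent {V : ℤ → X →ₗᵢ[ℂ] Y} {B : Y →L[ℂ] Y} {bm b0 bp : X →L[ℂ] X}
    (hB : ∀ n u, B (V n u) = V (n - 1) (bm u) + V n (b0 u) + V (n + 1) (bp u)) (f : ℤ →₀ X) :
    assemble V (laurent bm b0 bp f) = B (assemble V f) := by
  have h : assemble V ∘ₗ laurent bm b0 bp = B.toLinearMap ∘ₗ assemble V := by
    refine Finsupp.lhom_ext fun n a => ?_
    simp only [assemble, laurent, LinearMap.comp_apply, Finsupp.lsum_single, map_add,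
      LinearMap.add_apply, Finsupp.lsingle_apply, ContinuousLinearMap.coe_coe,
      LinearIsometry.coe_toLinearMap, hB]
  exact LinearMap.congr_fun h f

/-- By Parseval the squared inequality for a finite sum of blocks is the integral over `θ` of the
fibre inequalities; density and continuity do the rest. -/
theorem le_norm_of_le_norm_fibre {V : ℤ → X →ₗᵢ[ℂ] Y}
    (hV : OrthogonalFamily ℂ (fun _ : ℤ => X) V) (hdense : DenseRange (assemble V))
    {B : Y →L[ℂ] Y} {bm b0 bp : X →L[ℂ] X}
    (hB : ∀ n u, B (V n u) = V (n - 1) (bm u) + V n (b0 u) + V (n + 1) (bp u))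
    {δ : ℝ} (hδ : 0 ≤ δ)
    (h : ∀ θ ∈ Set.Icc (0 : ℝ) 1, ∀ u, δ * ‖u‖ ≤ ‖fibre bm b0 bp θ u‖) (y : Y) :
    δ * ‖y‖ ≤ ‖B y‖ := by
  refine hdense.induction_on (p := fun y => δ * ‖y‖ ≤ ‖B y‖) y
    (isClosed_le (by fun_prop) (by fun_prop)) fun f => ?_
  have hcont : ∀ g : ℤ →₀ X, Continuous fun θ => ‖trigPoly θ g‖ ^ 2 := by
    intro g
    simp_rw [trigPoly_apply]
    fun_prop
  have h2 : (δ * ‖assemble V f‖) ^ 2 ≤ ‖B (assemble V f)‖ ^ 2 := by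
    rw [← assemble_laurent hB, mul_pow, norm_sq_assemble hV, norm_sq_assemble hV,
      ← intervalIntegral.integral_const_mul]
    refine intervalIntegral.integral_mono_on zero_le_one
      (((hcont f).const_mul _).intervalIntegrable _ _) ((hcont _).intervalIntegrable _ _)
      fun θ hθ => ?_
    rw [trigPoly_laurent, ← mul_pow]
    have := h θ hθ (trigPoly θ f)
    gcongr
  exact (sq_le_sq₀ (by positivity) (by positivity)).1 h2

/-- Test `B` on the plane wave with amplitude `u` cut off to `N` blocks. Its norm is `√N * ‖u‖`, and
`B` turns it into the wave with amplitude `w`, up to edge terms bounded independently of `N`. -/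
theorem le_norm_fibre_of_le_norm {V : ℤ → X →ₗᵢ[ℂ] Y}
    (hV : OrthogonalFamily ℂ (fun _ : ℤ => X) V)
    {B : Y →L[ℂ] Y} {bm b0 bp : X →L[ℂ] X}
    (hB : ∀ n u, B (V n u) = V (n - 1) (bm u) + V n (b0 u) + V (n + 1) (bp u))
    {δ : ℝ} (h : ∀ y, δ * ‖y‖ ≤ ‖B y‖) (θ : ℝ) (u : X) :
    δ * ‖u‖ ≤ ‖fibre bm b0 bp θ u‖ := by
  set w := fibre bm b0 bp θ u with hw
  have hnorm : ∀ (N : ℕ) (x : X),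
      ‖∑ n ∈ Finset.range N, V n (expChar (n * θ) • x)‖ = √N * ‖x‖ := by
    intro N x
    have h0 := (hV.comp (f := fun n : ℕ => (n : ℤ)) Nat.cast_injective).norm_sum
      (fun n : ℕ => expChar (n * θ) • x) (Finset.range N)
    simp only [norm_smul, norm_expChar, one_mul, Finset.sum_const, Finset.card_range,
      nsmul_eq_mul] at h0
    rw [← Real.sqrt_sq (norm_nonneg (∑ n ∈ Finset.range N, V n (expChar (n * θ) • x))), h0,
      Real.sqrt_mul (by positivity), Real.sqrt_sq (norm_nonneg _)]
  -- The discrepancies caused by `bm` and `bp` telescope, so only the values of `g` and `q` at the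
  -- two ends survive.
  set g : ℕ → Y := fun k => V (k - 1) (expChar (k * θ) • bm u) with hg
  set q : ℕ → Y := fun k => V k (expChar ((k - 1) * θ) • bp u) with hq
  have hBsum : ∀ N : ℕ, B (∑ n ∈ Finset.range N, V n (expChar (n * θ) • u)) =
      ∑ n ∈ Finset.range N, V n (expChar (n * θ) • w) + ((q N - q 0) - (g N - g 0)) := by
    intro N
    rw [← Finset.sum_range_sub q, ← Finset.sum_range_sub g, ← Finset.sum_sub_distrib,
      ← Finset.sum_add_distrib, map_sum]
    refine Finset.sum_congr rfl fun n _ => ?_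
    have h1 : expChar (((n : ℝ) + 1) * θ) = expChar (n * θ) * expChar θ := by
      rw [← expChar_add]; ring_nf
    have h2 : expChar (((n : ℝ) - 1) * θ) = expChar (n * θ) * expChar (-θ) := by
      rw [← expChar_add]; ring_nf
    simp only [hB, hg, hq, hw, fibre, Nat.cast_add, Nat.cast_one, add_sub_cancel_right, h1, h2,
      map_smul, map_add, add_apply, smul_apply, smul_add, smul_smul]
    abel
  have hbound : ∀ N : ℕ, √N * (δ * ‖u‖) ≤ √N * ‖w‖ + (2 * ‖bp u‖ + 2 * ‖bm u‖) := by
    intro N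
    have hgn : ∀ k, ‖g k‖ = ‖bm u‖ := fun k => by simp [hg, norm_smul]
    have hqn : ∀ k, ‖q k‖ = ‖bp u‖ := fun k => by simp [hq, norm_smul]
    have h3 := h (∑ n ∈ Finset.range N, V n (expChar (n * θ) • u))
    rw [hBsum, hnorm] at h3
    have h4 : ‖(q N - q 0) - (g N - g 0)‖ ≤ 2 * ‖bp u‖ + 2 * ‖bm u‖ := by
      refine (norm_sub_le _ _).trans (add_le_add ?_ ?_)
      · refine (norm_sub_le _ _).trans ?_
        rw [hqn, hqn]; linarith
      · refine (norm_sub_le _ _).trans ?_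
        rw [hgn, hgn]; linarith
    calc √N * (δ * ‖u‖) = δ * (√N * ‖u‖) := by ring
      _ ≤ _ := h3
      _ ≤ _ := (norm_add_le _ _).trans (add_le_add (hnorm N w).le h4)
  by_contra! hlt
  set C := 2 * ‖bp u‖ + 2 * ‖bm u‖ with hC
  have hd : 0 < δ * ‖u‖ - ‖w‖ := by linarith
  obtain ⟨N, hN⟩ := exists_nat_gt ((C / (δ * ‖u‖ - ‖w‖)) ^ 2)
  have h5 : C / (δ * ‖u‖ - ‖w‖) < √N := Real.lt_sqrt_of_sq_lt hN
  rw [div_lt_iff₀ hd] at h5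
  have := hbound N
  nlinarith

end Transfer


/-! ### Decomposition of `ℓ²(ℤ²)` into columns -/

section Columns

theorem hasSum_norm_sq {ι : Type} (u : Ell2 ι) : HasSum (fun i => ‖u i‖ ^ 2) (‖u‖ ^ 2) := by
  simpa using lp.hasSum_norm (p := 2) (by norm_num) u

theorem hasSum_column (n : ℤ) (u : Ell2 ℤ) :
    HasSum (fun γ : ℤ × ℤ => ‖if γ.2 = n then u γ.1 else 0‖ ^ 2) (‖u‖ ^ 2) := by
  have hinj : Function.Injective fun m : ℤ => (m, n) := fun a b h => (Prod.ext_iff.1 h).1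
  rw [← hinj.hasSum_iff]
  · simpa [Function.comp_def] using hasSum_norm_sq u
  · rintro ⟨m, k⟩ hk
    have : k ≠ n := by rintro rfl; exact hk ⟨m, rfl⟩
    simp [this]

/-- The isometric embedding of `ℓ²(ℤ)` into `ℓ²(ℤ²)` as the column of second coordinate `n`. -/
noncomputable def column (n : ℤ) : Ell2 ℤ →ₗᵢ[ℂ] Ell2 (ℤ × ℤ) where
  toFun u := ⟨fun γ => if γ.2 = n then u γ.1 else 0, by
    refine memℓp_gen ?_
    simpa using (hasSum_column n u).summable⟩
  map_add' u v := by
    ext γ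
    change (if γ.2 = n then u γ.1 + v γ.1 else 0) =
      (if γ.2 = n then u γ.1 else 0) + (if γ.2 = n then v γ.1 else 0)
    split_ifs <;> simp
  map_smul' z u := by
    ext γ
    change (if γ.2 = n then z * u γ.1 else 0) = z * (if γ.2 = n then u γ.1 else 0)
    split_ifs <;> simp
  norm_map' u := by
    refine (sq_eq_sq₀ (norm_nonneg _) (norm_nonneg _)).1 ?_
    exact (hasSum_norm_sq _).unique (hasSum_column n u)

theorem column_apply (n : ℤ) (u : Ell2 ℤ) (m k : ℤ) :
    column n u (m, k) = if k = n then u m else 0 := rfl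

theorem orthogonalFamily_column : OrthogonalFamily ℂ (fun _ : ℤ => Ell2 ℤ) column := by
  intro n k hnk u v
  rw [lp.inner_eq_tsum]
  convert tsum_zero with γ
  obtain ⟨a, b⟩ := γ
  rw [column_apply, column_apply]
  by_cases h : b = n
  · have : b ≠ k := fun h' => hnk (h.symm.trans h')
    simp [this]
  · simp [h]

theorem denseRange_assemble_column : DenseRange (assemble column) := by
  intro ψ
  have hsingle : ∀ (γ : ℤ × ℤ) (z : ℂ),
      lp.single 2 γ z = assemble column (Finsupp.single γ.2 (lp.single 2 γ.1 z)) := by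
    rintro ⟨m, n⟩ z
    ext ⟨a, b⟩
    simp only [assemble, Finsupp.lsum_single, LinearIsometry.coe_toLinearMap, column_apply,
      lp.single_apply, Pi.single_apply, Prod.mk.injEq]
    split_ifs <;> simp_all
  refine mem_closure_of_tendsto (lp.hasSum_single (by norm_num) ψ) (.of_forall fun s => ?_)
  refine ⟨∑ γ ∈ s, Finsupp.single γ.2 (lp.single 2 γ.1 (ψ γ)), ?_⟩
  rw [map_sum]
  exact Finset.sum_congr rfl fun γ _ => (hsingle γ (ψ γ)).symm

end Columns

/-! ### The hopping operator, its fibres and the Jacobi matrix -/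

section Hopping

theorem adjoint_weightedShift {ι : Type} (σ : ι ≃ ι) (w : ι → ℂ) (C : ℝ) (hw : ∀ i, ‖w i‖ ≤ C) :
    ContinuousLinearMap.adjoint (weightedShift σ w C hw) =
      weightedShift σ.symm (fun i => conj (w (σ.symm i))) C
        (fun i => by rw [RCLike.norm_conj]; exact hw _) := by
  symm
  rw [ContinuousLinearMap.eq_adjoint_iff]
  intro x y
  rw [lp.inner_eq_tsum, lp.inner_eq_tsum, ← Equiv.tsum_eq σ]
  congr 1 with i
  simp only [weightedShift_apply, Equiv.symm_apply_apply]
  rw [RCLike.inner_apply, RCLike.inner_apply]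
  simp
  ring

theorem tau0_adjoint_apply (u : Ell2 (ℤ × ℤ)) (m n : ℤ) :
    ContinuousLinearMap.adjoint tau0 u (m, n) = u (m + 1, n) := by
  rw [tau0, adjoint_weightedShift, weightedShift_apply]
  simp [shiftFst]

theorem tau1_adjoint_apply (Φ : ℝ) (u : Ell2 (ℤ × ℤ)) (m n : ℤ) :
    ContinuousLinearMap.adjoint (tau1 Φ) u (m, n) = Complex.exp (Complex.I * Φ * m) * u (m, n + 1) := by
  rw [tau1, adjoint_weightedShift, weightedShift_apply]
  simp [shiftSnd, phase, ← Complex.exp_conj]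

/-- The hopping operator `1 + τ₀ + τ₁`. -/
noncomputable def hop (Φ : ℝ) : Ell2 (ℤ × ℤ) →L[ℂ] Ell2 (ℤ × ℤ) := 1 + tau0 + tau1 Φ

theorem hop_apply (Φ : ℝ) (u : Ell2 (ℤ × ℤ)) (m n : ℤ) :
    hop Φ u (m, n) = u (m, n) + u (m - 1, n) + Complex.exp (-Complex.I * Φ * m) * u (m, n - 1) := by
  rw [← tau0_apply, ← tau1_apply]
  rfl

theorem hop_adjoint_apply (Φ : ℝ) (u : Ell2 (ℤ × ℤ)) (m n : ℤ) :
    ContinuousLinearMap.adjoint (hop Φ) u (m, n) =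
      u (m, n) + u (m + 1, n) + Complex.exp (Complex.I * Φ * m) * u (m, n + 1) := by
  rw [← tau0_adjoint_apply, ← tau1_adjoint_apply, hop, map_add, map_add,
    ← ContinuousLinearMap.star_eq_adjoint 1, star_one]
  rfl

/-- The right shift on `ℓ²(ℤ)`. -/
noncomputable def rshift : Ell2 ℤ →L[ℂ] Ell2 ℤ :=
  weightedShift (Equiv.subRight 1) (fun _ => 1) 1 (fun _ => by simp)

/-- The left shift on `ℓ²(ℤ)`. -/
noncomputable def lshift : Ell2 ℤ →L[ℂ] Ell2 ℤ :=
  weightedShift (Equiv.addRight 1) (fun _ => 1) 1 (fun _ => by simp)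

/-- Multiplication by `exp (-iΦm)` on `ℓ²(ℤ)`. -/
noncomputable def modulation (Φ : ℝ) : Ell2 ℤ →L[ℂ] Ell2 ℤ :=
  weightedShift (Equiv.refl ℤ) (fun m => Complex.exp (-Complex.I * Φ * m)) 1
    (fun m => by simp [Complex.norm_exp])

/-- Multiplication by `exp (iΦm)` on `ℓ²(ℤ)`. -/
noncomputable def modulationInv (Φ : ℝ) : Ell2 ℤ →L[ℂ] Ell2 ℤ :=
  weightedShift (Equiv.refl ℤ) (fun m => Complex.exp (Complex.I * Φ * m)) 1
    (fun m => by simp [Complex.norm_exp])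

theorem rshift_apply (u : Ell2 ℤ) (m : ℤ) : rshift u m = u (m - 1) := by
  simp [rshift, weightedShift_apply]

theorem lshift_apply (u : Ell2 ℤ) (m : ℤ) : lshift u m = u (m + 1) := by
  simp [lshift, weightedShift_apply]

theorem modulation_apply (Φ : ℝ) (u : Ell2 ℤ) (m : ℤ) :
    modulation Φ u m = Complex.exp (-Complex.I * Φ * m) * u m := rfl

theorem modulationInv_apply (Φ : ℝ) (u : Ell2 ℤ) (m : ℤ) :
    modulationInv Φ u m = Complex.exp (Complex.I * Φ * m) * u m := rfl

theorem hop_column (Φ : ℝ) (n : ℤ) (u : Ell2 ℤ) :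
    hop Φ (column n u) = column (n - 1) ((0 : Ell2 ℤ →L[ℂ] Ell2 ℤ) u) +
      column n ((1 + rshift) u) + column (n + 1) (modulation Φ u) := by
  ext ⟨m, k⟩
  have h1 : k - 1 = n ↔ k = n + 1 := by lia
  simp only [hop_apply, column_apply, h1, lp.coeFn_add, Pi.add_apply, zero_apply, map_zero,
    zero_add, add_apply, one_apply_eq_self, rshift_apply,
    modulation_apply]
  split_ifs <;> simp

theorem hop_adjoint_column (Φ : ℝ) (n : ℤ) (u : Ell2 ℤ) :
    ContinuousLinearMap.adjoint (hop Φ) (column n u) = column (n - 1) (modulationInv Φ u) +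
      column n ((1 + lshift) u) + column (n + 1) ((0 : Ell2 ℤ →L[ℂ] Ell2 ℤ) u) := by
  ext ⟨m, k⟩
  have h1 : k + 1 = n ↔ k = n - 1 := by lia
  simp only [hop_adjoint_apply, column_apply, h1, lp.coeFn_add, Pi.add_apply, zero_apply, map_zero,
    add_zero, add_apply, one_apply_eq_self, lshift_apply,
    modulationInv_apply]
  split_ifs <;> ring

theorem hop_mul_adjoint_sub_column (Φ : ℝ) (z : ℂ) (n : ℤ) (u : Ell2 ℤ) :
    (hop Φ * ContinuousLinearMap.adjoint (hop Φ) - z • 1) (column n u) =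
      column (n - 1) (((1 + rshift) * modulationInv Φ) u) +
      column n (((1 + rshift) * (1 + lshift) + modulation Φ * modulationInv Φ - z • 1) u) +
      column (n + 1) ((modulation Φ * (1 + lshift)) u) := by
  rw [sub_apply, mul_apply_eq_comp, hop_adjoint_column]
  simp only [map_add, hop_column, sub_apply, mul_apply_eq_comp, smul_apply, one_apply_eq_self,
    map_sub, map_smul, add_apply, map_zero, zero_apply, sub_add_cancel]
  abel

/-- The fibre of the hopping operator at quasi-momentum `θ`. -/
noncomputable def fibreHop (Φ θ : ℝ) : Ell2 ℤ →L[ℂ] Ell2 ℤ :=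
  fibre 0 (1 + rshift) (modulation Φ) θ

/-- The adjoint of the fibre of the hopping operator at quasi-momentum `θ`. -/
noncomputable def fibreHopAdj (Φ θ : ℝ) : Ell2 ℤ →L[ℂ] Ell2 ℤ :=
  fibre (modulationInv Φ) (1 + lshift) 0 θ

theorem fibreHop_apply (Φ θ : ℝ) (u : Ell2 ℤ) (m : ℤ) :
    fibreHop Φ θ u m = u (m - 1) + (1 + expChar (-θ) * Complex.exp (-Complex.I * Φ * m)) * u m := by
  simp only [fibreHop, fibre, add_apply, smul_apply, lp.coeFn_add, lp.coeFn_smul, Pi.add_apply,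
    Pi.smul_apply, one_apply_eq_self, rshift_apply, modulation_apply, zero_apply, lp.coeFn_zero,
    Pi.zero_apply, smul_eq_mul]
  ring

theorem fibreHopAdj_apply (Φ θ : ℝ) (u : Ell2 ℤ) (m : ℤ) :
    fibreHopAdj Φ θ u m = u (m + 1) + (1 + expChar θ * Complex.exp (Complex.I * Φ * m)) * u m := by
  simp only [fibreHopAdj, fibre, add_apply, smul_apply, lp.coeFn_add, lp.coeFn_smul, Pi.add_apply,
    Pi.smul_apply, one_apply_eq_self, lshift_apply, modulationInv_apply, zero_apply, lp.coeFn_zero,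
    Pi.zero_apply, smul_eq_mul]
  ring

theorem adjoint_fibreHop (Φ θ : ℝ) :
    ContinuousLinearMap.adjoint (fibreHop Φ θ) = fibreHopAdj Φ θ := by
  have h1 : ContinuousLinearMap.adjoint rshift = lshift := by
    ext u m
    rw [rshift, adjoint_weightedShift, weightedShift_apply, lshift_apply]
    simp
  have h2 : ContinuousLinearMap.adjoint (modulation Φ) = modulationInv Φ := by
    ext u m
    rw [modulation, adjoint_weightedShift, weightedShift_apply, modulationInv_apply]
    simp [← Complex.exp_conj]
  rw [fibreHop, fibreHopAdj, fibre, fibre, map_add, map_add, map_add, map_smulₛₗ, map_smulₛₗ, h1, h2,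
    conj_expChar, conj_expChar, neg_neg, ← ContinuousLinearMap.star_eq_adjoint 1, star_one, map_zero]
  simp only [smul_zero, zero_add, add_zero]
  abel

/-- The blocks are those of `hop_mul_adjoint_sub_column`, so the transfer lemmas apply to `T T* - z`
with these fibres. -/
theorem fibreHop_mul_fibreHopAdj_sub (Φ : ℝ) (z : ℂ) (θ : ℝ) :
    fibreHop Φ θ * fibreHopAdj Φ θ - z • 1 =
      fibre ((1 + rshift) * modulationInv Φ)
        ((1 + rshift) * (1 + lshift) + modulation Φ * modulationInv Φ - z • 1)
        (modulation Φ * (1 + lshift)) θ := by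
  have h : expChar (-θ) * expChar θ = 1 := by rw [mul_comm, expChar_mul_neg]
  simp only [fibreHop, fibreHopAdj, fibre, smul_zero, zero_add, add_zero]
  generalize (1 + rshift) = a
  generalize (1 + lshift) = b
  rw [add_mul, mul_add, mul_add, mul_smul_comm, smul_mul_assoc, smul_mul_assoc, mul_smul_comm,
    smul_smul, h, one_smul]
  abel

theorem c_eq (Φ θ x : ℝ) : c (θ + x * (Φ / (2 * Real.pi))) =
    1 + expChar (-θ) * Complex.exp (-Complex.I * Φ * x) := by
  rw [c, expChar, ← Complex.exp_add]
  congr 2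
  have : (Real.pi : ℂ) ≠ 0 := by exact_mod_cast Real.pi_ne_zero
  push_cast
  field_simp
  ring

/-- With `a m = c (θ + m Φ / 2π)`, the fibre `T_θ` has diagonal `a m` and subdiagonal `1`. Hence
`T_θ T_θ*` has off-diagonal coefficients `a m` and `conj (a (m - 1))`, and diagonal `1 + |a m|² = 3
+ v`. -/
theorem H_eq_fibreHop_mul_sub (Φ θ : ℝ) : H Φ θ = fibreHop Φ θ * fibreHopAdj Φ θ - (3 : ℂ) • 1 := by
  ext u m
  have hconj : ∀ x : ℝ, conj (1 + expChar (-θ) * Complex.exp (-Complex.I * Φ * x)) =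
      1 + expChar θ * Complex.exp (Complex.I * Φ * x) := by
    intro x
    rw [map_add, map_mul, conj_expChar, neg_neg, ← Complex.exp_conj]
    simp
  have hv : ∀ x : ℝ, ((v (θ + x * (Φ / (2 * Real.pi))) : ℝ) : ℂ) =
      expChar (-θ) * Complex.exp (-Complex.I * Φ * x) + expChar θ * Complex.exp (Complex.I * Φ * x)
        := by
    intro x
    have hπ : (Real.pi : ℂ) ≠ 0 := by exact_mod_cast Real.pi_ne_zero
    rw [v, expChar, expChar, ← Complex.exp_add, ← Complex.exp_add]
    push_cast
    rw [Complex.two_cos, add_comm]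
    congr 2 <;> field_simp <;> ring
  have hunit : expChar (-θ) * Complex.exp (-Complex.I * Φ * m) *
      (expChar θ * Complex.exp (Complex.I * Φ * m)) = 1 := by
    have h1 := expChar_mul_neg θ
    have h2 : Complex.exp (-Complex.I * Φ * m) * Complex.exp (Complex.I * Φ * m) = 1 := by
      rw [← Complex.exp_add, ← Complex.exp_zero]; ring_nf
    calc _ = (expChar θ * expChar (-θ)) *
        (Complex.exp (-Complex.I * Φ * m) * Complex.exp (Complex.I * Φ * m)) := by ring
      _ = 1 := by rw [h1, h2, one_mul]
  have h1 := c_eq Φ θ m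
  have h2 := hv m
  have h3 := c_eq Φ θ ((m : ℝ) - 1)
  have h4 := hconj ((m : ℝ) - 1)
  push_cast at h1 h2 h3 h4
  rw [H_apply, h1, h3, h4, h2, sub_apply, mul_apply_eq_comp, lp.coeFn_sub, Pi.sub_apply,
    fibreHop_apply, fibreHopAdj_apply, fibreHopAdj_apply, smul_apply, one_apply_eq_self,
    lp.coeFn_smul, Pi.smul_apply, smul_eq_mul, sub_add_cancel]
  push_cast
  linear_combination (-u m) * hunit

end Hopping


/-! ### The union of the fibre spectra -/

section Spectrum

theorem continuous_fibre {X : Type} [NormedAddCommGroup X] [InnerProductSpace ℂ X]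
    (bm b0 bp : X →L[ℂ] X) : Continuous (fibre bm b0 bp) := by
  unfold fibre
  fun_prop

/-- A continuous family of invertible operators is bounded below uniformly on compact sets. -/
theorem exists_uniform_bound {X : Type} [NormedAddCommGroup X] [InnerProductSpace ℂ X]
    [CompleteSpace X] {F : ℝ → X →L[ℂ] X} (hF : Continuous F) (hu : ∀ θ, IsUnit (F θ)) :
    ∃ δ : ℝ, 0 < δ ∧ ∀ θ ∈ Set.Icc (0 : ℝ) 1, ∀ u, δ * ‖u‖ ≤ ‖F θ u‖ := by
  have hcont : Continuous fun θ => Ring.inverse (F θ) := by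
    rw [continuous_iff_continuousAt]
    intro θ
    have h : ContinuousAt Ring.inverse (F θ) := NormedRing.inverse_continuousAt (hu θ).unit
    exact h.comp hF.continuousAt
  obtain ⟨M, hM⟩ := (isCompact_Icc (a := (0 : ℝ)) (b := 1)).exists_bound_of_continuousOn
    hcont.continuousOn
  have hM1 : 0 < |M| + 1 := by positivity
  refine ⟨(|M| + 1)⁻¹, by positivity, fun θ hθ u => ?_⟩
  rw [inv_mul_le_iff₀ hM1]
  have h : Ring.inverse (F θ) (F θ u) = u := by
    rw [← mul_apply_eq_comp, Ring.inverse_mul_cancel _ (hu θ), one_apply_eq_self]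
  calc ‖u‖ = ‖Ring.inverse (F θ) (F θ u)‖ := by rw [h]
    _ ≤ ‖Ring.inverse (F θ)‖ * ‖F θ u‖ := ContinuousLinearMap.le_opNorm _ _
    _ ≤ _ := by gcongr; linarith [hM θ hθ, le_abs_self M]

theorem isSelfAdjoint_fibreHop_mul (Φ θ : ℝ) (r : ℝ) :
    IsSelfAdjoint (fibreHop Φ θ * fibreHopAdj Φ θ - (r : ℂ) • 1) := by
  rw [← adjoint_fibreHop, ← ContinuousLinearMap.star_eq_adjoint]
  exact (IsSelfAdjoint.mul_star_self _).sub
    (IsSelfAdjoint.smul (by simp [isSelfAdjoint_iff]) (.one _))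

theorem isSelfAdjoint_H (Φ θ : ℝ) : IsSelfAdjoint (H Φ θ) := by
  rw [H_eq_fibreHop_mul_sub]
  have h := isSelfAdjoint_fibreHop_mul Φ θ 3
  rwa [Complex.ofReal_ofNat] at h

theorem mem_spectrum_H_iff (Φ θ E : ℝ) : (E : ℂ) ∈ spectrum ℂ (H Φ θ) ↔
    ¬ IsBoundedBelow (fibreHop Φ θ * fibreHopAdj Φ θ - ((E + 3 : ℝ) : ℂ) • 1) := by
  rw [mem_spectrum_iff_not_isBoundedBelow (isSelfAdjoint_H Φ θ), H_eq_fibreHop_mul_sub, sub_sub, ← add_smul]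
  push_cast
  rw [add_comm (3 : ℂ)]

/-- The spectrum of `T T*`, for `T` the hopping operator, is the union of the fibre spectra. -/
theorem mem_unionSpectrum_iff (Φ E : ℝ) : (E : ℂ) ∈ unionSpectrum Φ ↔
    ¬ IsBoundedBelow
      (hop Φ * ContinuousLinearMap.adjoint (hop Φ) - ((E + 3 : ℝ) : ℂ) • 1) := by
  simp only [unionSpectrum, Set.mem_iUnion, mem_spectrum_H_iff]
  rw [← not_forall, not_iff_not]
  constructor
  · intro h
    -- The bounds in `h` may depend on `θ`; invertibility, norm continuity and compactness of `[0,
    -- 1]` make them uniform.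
    have hunit : ∀ θ, IsUnit (fibreHop Φ θ * fibreHopAdj Φ θ - ((E + 3 : ℝ) : ℂ) • 1) :=
      fun θ => isUnit_of_isBoundedBelow (isSelfAdjoint_fibreHop_mul Φ θ _) (h θ)
    simp_rw [fibreHop_mul_fibreHopAdj_sub] at hunit
    obtain ⟨δ, hδ, hb⟩ := exists_uniform_bound (continuous_fibre _ _ _) hunit
    exact ⟨δ, hδ, le_norm_of_le_norm_fibre orthogonalFamily_column denseRange_assemble_column
      (hop_mul_adjoint_sub_column Φ _) hδ.le hb⟩
  · rintro ⟨δ, hδ, hb⟩ θ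
    rw [fibreHop_mul_fibreHopAdj_sub]
    exact ⟨δ, hδ, le_norm_fibre_of_le_norm orthogonalFamily_column
      (hop_mul_adjoint_sub_column Φ _) hb θ⟩

theorem unionSpectrum_subset (Φ : ℝ) :
    unionSpectrum Φ ⊆ (fun E : ℝ => (E : ℂ)) '' Set.Ici (-3) := by
  intro z hz
  obtain ⟨θ, hθ⟩ := Set.mem_iUnion.1 hz
  have hre : z = (z.re : ℂ) := (isSelfAdjoint_H Φ θ).mem_spectrum_eq_re hθ
  rw [hre] at hθ
  refine ⟨z.re, ?_, hre.symm⟩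
  rw [Set.mem_Ici]
  by_contra! hlt
  refine (mem_spectrum_H_iff Φ θ z.re).1 hθ ?_
  rw [← adjoint_fibreHop]
  exact isBoundedBelow_mul_adjoint_sub _ (by linarith)

end Spectrum

/-! ### Zero belongs to the spectrum -/

section ZeroMode

/-- The matrix entry `g (-1)` of a column `g` of the inverse of the injective bidiagonal fibre
is an idempotent. -/
theorem entry_idempotent {Φ θ : ℝ} (hinj : ∀ u, fibreHop Φ θ u = 0 → u = 0) {g : Ell2 ℤ}
    (hg : fibreHop Φ θ g = lp.single 2 0 1) : (1 - g (-1)) * g (-1) = 0 := by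
  -- Rescaling `g` differently on the two half-lines affects the recurrence only at `m = 0`. There
  -- the two constants cancel the source term, so `w * g` lies in the kernel.
  set w : ℤ → ℂ := fun m => if m < 0 then 1 - g (-1) else - g (-1) with hw
  have hwb : ∀ m, ‖w m‖ ≤ 1 + ‖g (-1)‖ := by
    intro m
    simp only [hw]
    split_ifs
    · exact (norm_sub_le _ _).trans (by simp)
    · simp
  have hrec : ∀ m : ℤ, g (m - 1) + (1 + expChar (-θ) * Complex.exp (-Complex.I * Φ * m)) * g m =
      if m = 0 then 1 else 0 := by
    intro m
    rw [← fibreHop_apply, hg, lp.single_apply, Pi.single_apply]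
  have h0 : weightedShift (Equiv.refl ℤ) w _ hwb g = 0 := by
    refine hinj _ ?_
    ext m
    rw [fibreHop_apply, weightedShift_apply, weightedShift_apply]
    simp only [hw, Equiv.refl_apply, lp.coeFn_zero, Pi.zero_apply]
    have h := hrec m
    rcases lt_trichotomy m 0 with hm | rfl | hm
    · rw [if_neg hm.ne] at h
      rw [if_pos (by lia), if_pos hm]
      linear_combination (1 - g (-1)) * h
    · simp only [zero_sub, if_true] at h ⊢
      simp only [Left.neg_neg_iff, zero_lt_one, if_true, lt_irrefl, if_false]
      linear_combination (- g (-1)) * h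
    · rw [if_neg hm.ne'] at h
      rw [if_neg (by lia), if_neg (by lia)]
      linear_combination (- g (-1)) * h
  have h1 : weightedShift (Equiv.refl ℤ) w _ hwb g (-1) = 0 := by rw [h0]; rfl
  simpa [weightedShift_apply, hw] using h1

/-- By Parseval the integral is the sum of the squared moduli of all coefficients, the constant one
included. -/
theorem one_le_integral_polynomial (P : Polynomial ℂ) (hP : ‖P.coeff 0‖ = 1) :
    1 ≤ ∫ θ in (0 : ℝ)..1, ‖P.eval (expChar (-θ))‖ ^ 2 := by
  have hpow : ∀ (n : ℕ) (θ : ℝ), expChar (-θ) ^ n = expChar (-(n * θ)) := by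
    intro n θ
    rw [expChar, expChar, ← Complex.exp_nat_mul]
    push_cast
    ring_nf
  have heval : ∀ θ : ℝ, P.eval (expChar (-θ)) =
      ∑ n ∈ (Finset.range (P.natDegree + 1)).map Nat.castEmbedding,
        expChar (-((n : ℤ) * θ)) • P.coeff n.toNat := by
    intro θ
    rw [Polynomial.eval_eq_sum_range, Finset.sum_map]
    refine Finset.sum_congr rfl fun n _ => ?_
    rw [hpow, smul_eq_mul, mul_comm]
    simp
  simp_rw [heval]
  rw [integral_norm_sq_trigPoly, Finset.sum_map]
  have := Finset.single_le_sum (f := fun n : ℕ => ‖P.coeff n‖ ^ 2)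
    (fun n _ => by positivity) (Finset.mem_range.2 (Nat.succ_pos P.natDegree))
  simpa [hP] using this

theorem not_forall_fibres_bounded_below (Φ : ℝ) {δ ε : ℝ} (hδ : 0 < δ) (hε : 0 < ε)
    (h1 : ∀ θ u, δ * ‖u‖ ≤ ‖fibreHop Φ θ u‖) (h2 : ∀ θ u, ε * ‖u‖ ≤ ‖fibreHopAdj Φ θ u‖) :
    False := by
  have hinj : ∀ θ u, fibreHop Φ θ u = 0 → u = 0 := fun θ =>
    IsBoundedBelow.injective ⟨δ, hδ, h1 θ⟩
  have hsurj : ∀ θ, ∃ g, fibreHop Φ θ g = lp.single 2 0 1 := by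
    intro θ
    -- Surjectivity of `T_θ` is obtained from `T_θ T_θ*`, which is self-adjoint and bounded below;
    -- this is where the bound on the adjoint enters.
    have hsa : IsSelfAdjoint (fibreHop Φ θ * fibreHopAdj Φ θ) := by
      simpa using isSelfAdjoint_fibreHop_mul Φ θ 0
    have hu := isUnit_of_isBoundedBelow hsa
      (IsBoundedBelow.mul ⟨δ, hδ, h1 θ⟩ ⟨ε, hε, h2 θ⟩)
    obtain ⟨x, hx⟩ := (ContinuousLinearMap.isUnit_iff_bijective.1 hu).2 (lp.single 2 0 1)
    exact ⟨_, hx⟩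
  choose g hg using hsurj
  have hrec : ∀ (θ : ℝ) (m : ℤ),
      g θ (m - 1) + (1 + expChar (-θ) * Complex.exp (-Complex.I * Φ * m)) * g θ m =
      if m = 0 then 1 else 0 := by
    intro θ m
    rw [← fibreHop_apply, hg, lp.single_apply, Pi.single_apply]
  have hgnorm : ∀ θ, ‖g θ‖ ≤ δ⁻¹ := by
    intro θ
    have := h1 θ (g θ)
    rw [hg, lp.norm_single (by norm_num), norm_one] at this
    rwa [← one_div, le_div_iff₀' hδ]
  have hgcont : Continuous g := by
    -- Apply the lower bound to `g θ - g θ'`, which `T_θ` sends to `(T_θ' - T_θ) (g θ')`.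
    have hdist : ∀ θ θ', dist (g θ) (g θ') ≤ δ⁻¹ * (‖fibreHop Φ θ' - fibreHop Φ θ‖ * δ⁻¹) := by
      intro θ θ'
      rw [dist_eq_norm, le_inv_mul_iff₀ hδ]
      refine (h1 θ _).trans ?_
      have : fibreHop Φ θ (g θ - g θ') = (fibreHop Φ θ' - fibreHop Φ θ) (g θ') := by
        rw [map_sub, sub_apply, hg, hg]
      rw [this]
      exact (ContinuousLinearMap.le_opNorm _ _).trans
        (mul_le_mul_of_nonneg_left (hgnorm θ') (norm_nonneg _))
    rw [continuous_iff_continuousAt]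
    intro θ₀
    rw [ContinuousAt, tendsto_iff_dist_tendsto_zero]
    refine squeeze_zero (fun _ => dist_nonneg) (fun θ => hdist θ θ₀) ?_
    have hc : Continuous fun θ => δ⁻¹ * (‖fibreHop Φ θ₀ - fibreHop Φ θ‖ * δ⁻¹) := by
      have : Continuous (fibreHop Φ) := continuous_fibre _ _ _
      fun_prop
    simpa using hc.tendsto θ₀
  have hcoord : ∀ m : ℤ, Continuous fun θ => g θ m := fun m =>
    (lp.evalCLM ℂ (fun _ : ℤ => ℂ) 2 m).continuous.comp hgcont
  have hval : ∀ θ, g θ (-1) ∈ ({0, 1} : Set ℂ) := by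
    intro θ
    rcases mul_eq_zero.1 (entry_idempotent (hinj θ) (hg θ)) with h | h
    · right; exact (sub_eq_zero.1 h).symm
    · left; exact h
  have hone : ∀ θ, g θ (-1) = 1 := by
    intro θ
    -- At `θ = 1/2` the coefficient of `g θ 0` in the equation at site `0` vanishes, leaving `g θ
    -- (-1) = 1`.
    have hhalf : g (1 / 2) (-1) = 1 := by
      have he : expChar (-(1 / 2)) = -1 := by
        have harg : 2 * Real.pi * Complex.I * ((-(1 / 2) : ℝ) : ℂ) = -(Real.pi * Complex.I) := by
          push_cast
          ring
        rw [expChar, harg, Complex.exp_neg, Complex.exp_pi_mul_I, inv_neg, inv_one]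
      have := hrec (1 / 2) 0
      rw [he] at this
      simpa using this
    rw [← hhalf]
    exact isPreconnected_univ.constant_of_mapsTo (Set.toFinite _).isDiscrete (hcoord (-1)).continuousOn
      (fun θ _ => hval θ) (Set.mem_univ _) (Set.mem_univ _)
  -- Left of `-1` the recurrence has no source and is solved by multiplying by `-a m` at each step;
  -- `P k` is this product as a polynomial in `exp (-2πiθ)`.
  let P : ℕ → Polynomial ℂ := fun k => ∏ j ∈ Finset.range k,
    (-(1 + Polynomial.C (Complex.exp (-Complex.I * Φ * (-1 - j : ℤ))) * Polynomial.X))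
  have hgP : ∀ (k : ℕ) (θ : ℝ), g θ (-1 - k) = (P k).eval (expChar (-θ)) := by
    intro k θ
    induction k with
    | zero => simpa [P] using hone θ
    | succ k ih =>
      have h := hrec θ (-1 - k)
      rw [if_neg (by lia), ih] at h
      simp only [P] at h ⊢
      rw [Finset.prod_range_succ, Polynomial.eval_mul]
      have hidx : (-1 - ((k + 1 : ℕ) : ℤ)) = -1 - k - 1 := by push_cast; ring
      rw [hidx, eq_neg_of_add_eq_zero_left h]
      simp only [Polynomial.eval_neg, Polynomial.eval_add, Polynomial.eval_one,
        Polynomial.eval_mul, Polynomial.eval_C, Polynomial.eval_X]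
      ring
  have hcoeff : ∀ k, ‖(P k).coeff 0‖ = 1 := by
    intro k
    simp [P, Polynomial.coeff_zero_prod]
  have hlow : ∀ K : ℕ, (K : ℝ) ≤ δ⁻¹ ^ 2 := by
    intro K
    calc (K : ℝ) = ∑ k ∈ Finset.range K, 1 := by simp
      _ ≤ ∑ k ∈ Finset.range K, ∫ θ in (0 : ℝ)..1, ‖g θ (-1 - k)‖ ^ 2 := by
        refine Finset.sum_le_sum fun k _ => ?_
        simp_rw [hgP]
        exact one_le_integral_polynomial _ (hcoeff k)
      _ = ∫ θ in (0 : ℝ)..1, ∑ k ∈ Finset.range K, ‖g θ (-1 - k)‖ ^ 2 := by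
        rw [intervalIntegral.integral_finsetSum]
        exact fun k _ => (((hcoord _).norm.pow 2).intervalIntegrable _ _)
      _ ≤ ∫ θ in (0 : ℝ)..1, δ⁻¹ ^ 2 := by
        refine intervalIntegral.integral_mono_on zero_le_one ?_ (by simp) fun θ _ => ?_
        · exact (continuous_finsetSum _ fun k _ =>
            (hcoord _).norm.pow 2).intervalIntegrable _ _
        · have hinj' : Function.Injective fun k : ℕ => (-1 - k : ℤ) := by
            intro a b hab
            simpa using hab
          have := sum_le_hasSum ((Finset.range K).map ⟨_, hinj'⟩)
            (fun i _ => by positivity) (hasSum_norm_sq (g θ))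
          rw [Finset.sum_map] at this
          refine this.trans ?_
          have := hgnorm θ
          gcongr
      _ = δ⁻¹ ^ 2 := by simp
  obtain ⟨K, hK⟩ := exists_nat_gt (δ⁻¹ ^ 2)
  exact absurd (hlow K) (not_le.2 hK)

theorem not_isBoundedBelow_offDiag_hop (Φ : ℝ) : ¬ IsBoundedBelow (offDiag (hop Φ)) := by
  intro h
  obtain ⟨⟨δ, hδ, h1⟩, ⟨ε, hε, h2⟩⟩ := h.of_offDiag
  exact not_forall_fibres_bounded_below Φ hδ hε
    (le_norm_fibre_of_le_norm orthogonalFamily_column (hop_column Φ) h1)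
    (le_norm_fibre_of_le_norm orthogonalFamily_column (hop_adjoint_column Φ) h2)

end ZeroMode

/-! ### The spectrum of `Q` -/

section SpectrumQ

theorem isSelfAdjoint_Q (Φ : ℝ) : IsSelfAdjoint (Q Φ) :=
  IsSelfAdjoint.smul (by simp [isSelfAdjoint_iff]) (isSelfAdjoint_offDiag _)

/-- The factor `1/3` in `Q` turns `x` into `3 * x` for the block operator, and `(3 * x) ^ 2 = E + 3`
means `E = 9 * x ^ 2 - 3`. -/
theorem mem_spectrum_Q_iff (Φ x : ℝ) : (x : ℂ) ∈ spectrum ℂ (Q Φ) ↔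
    x = 0 ∨ ((9 * x ^ 2 - 3 : ℝ) : ℂ) ∈ unionSpectrum Φ := by
  have hQ : Q Φ - (x : ℂ) • 1 = (1 / 3 : ℂ) • (offDiag (hop Φ) - ((3 * x : ℝ) : ℂ) • 1) := by
    rw [smul_sub, smul_smul, Q, hop]
    congr 2
    push_cast
    ring
  rw [mem_spectrum_iff_not_isBoundedBelow (isSelfAdjoint_Q Φ), hQ,
    isBoundedBelow_smul_iff (by norm_num)]
  by_cases hx : x = 0
  · rw [hx, mul_zero, isBoundedBelow_sub_zero_smul]
    simpa using not_isBoundedBelow_offDiag_hop Φ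
  · rw [isBoundedBelow_offDiag_sub_iff _ (by simpa using hx), mem_unionSpectrum_iff]
    have : (3 * x) ^ 2 = 9 * x ^ 2 - 3 + 3 := by ring
    simp only [hx, false_or, this]

theorem spectrum_Q (Φ : ℝ) : spectrum ℂ (Q Φ) = (fun x : ℝ => (x : ℂ)) ''
    ({x : ℝ | ∃ E : ℝ, (E : ℂ) ∈ unionSpectrum Φ ∧
      (x = Real.sqrt (E / 9 + 1 / 3) ∨ x = -Real.sqrt (E / 9 + 1 / 3))} ∪ {0}) := by
  ext z
  constructor
  · intro hz
    have hre : z = (z.re : ℂ) := (isSelfAdjoint_Q Φ).mem_spectrum_eq_re hz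
    rw [hre] at hz
    refine ⟨z.re, ?_, hre.symm⟩
    rcases (mem_spectrum_Q_iff Φ z.re).1 hz with h | h
    · right; exact h
    · refine .inl ⟨9 * z.re ^ 2 - 3, h, ?_⟩
      have : (9 * z.re ^ 2 - 3) / 9 + 1 / 3 = z.re ^ 2 := by ring
      rw [this, Real.sqrt_sq_eq_abs]
      rcases abs_choice z.re with h | h
      · left; exact h.symm
      · right; rw [h, neg_neg]
  · rintro ⟨x, ⟨E, hE, hx⟩ | hx, rfl⟩
    · obtain ⟨E', hE', hEE⟩ := unionSpectrum_subset Φ hE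
      obtain rfl : E' = E := Complex.ofReal_injective hEE
      rw [Set.mem_Ici] at hE'
      have hsq : x ^ 2 = E' / 9 + 1 / 3 := by
        rcases hx with rfl | rfl
        · rw [Real.sq_sqrt (by linarith)]
        · rw [neg_sq, Real.sq_sqrt (by linarith)]
      refine (mem_spectrum_Q_iff Φ x).2 (.inr ?_)
      convert hE using 2
      rw [hsq]
      ring
    · exact (mem_spectrum_Q_iff Φ x).2 (.inl hx)

end SpectrumQ


/-! ### Projections onto subspaces determined by few data -/

section Projection

variable {W : Type} [NormedAddCommGroup W] [InnerProductSpace ℂ W]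

/-- If the elements of `K` are determined at the orthonormal vectors `b i` by their inner products
with finitely many vectors `d k`, the projections of the `b i` have total square norm at most the
number of the `d k`. -/
theorem sum_norm_sq_starProjection_le (K : Submodule ℂ W) [K.HasOrthogonalProjection]
    {B D : Type} [Fintype B] [Fintype D] {b : B → W} (hb : Orthonormal ℂ b) (d : D → W)
    (h : ∀ ψ ∈ K, (∀ k, inner ℂ (d k) ψ = 0) → ∀ i, inner ℂ (b i) ψ = 0) :
    ∑ i, ‖K.starProjection (b i)‖ ^ 2 ≤ Fintype.card D := by
  set U : Submodule ℂ W := Submodule.span ℂ (Set.range fun i => K.starProjection (b i)) with hU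
  have hUK : U ≤ K := by
    rw [hU, Submodule.span_le]
    rintro _ ⟨i, rfl⟩
    exact Submodule.starProjection_apply_mem _ _
  have hfin : FiniteDimensional ℂ U := FiniteDimensional.span_of_finite ℂ (Set.finite_range _)
  have hinner : ∀ i, ∀ ψ ∈ K, inner ℂ ψ (K.starProjection (b i)) = inner ℂ ψ (b i) := by
    intro i ψ hψ
    rw [← Submodule.inner_starProjection_left_eq_right, Submodule.starProjection_eq_self_iff.2 hψ]
  let R : W →ₗ[ℂ] (D → ℂ) := LinearMap.pi fun k => (innerSL ℂ (d k)).toLinearMap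
  -- A vector of `U` killed by every `d k` is orthogonal to every `b i`, hence to their projections,
  -- which span `U`; so it is orthogonal to itself.
  have hR : Function.Injective (R.domRestrict U) := by
    rw [← LinearMap.ker_eq_bot, LinearMap.ker_eq_bot']
    rintro ⟨ψ, hψ⟩ hRψ
    have h0 : ∀ i, inner ℂ (b i) ψ = 0 := h ψ (hUK hψ) fun k => congrFun hRψ k
    have h1 : U ≤ (Submodule.span ℂ {ψ})ᗮ := by
      rw [hU, Submodule.span_le]
      rintro _ ⟨i, rfl⟩
      refine Submodule.mem_orthogonal_singleton_iff_inner_right.2 ?_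
      rw [hinner i ψ (hUK hψ), ← inner_conj_symm, h0, map_zero]
    have h2 : ψ = 0 :=
      inner_self_eq_zero.1 (Submodule.mem_orthogonal_singleton_iff_inner_right.1 (h1 hψ))
    exact Subtype.ext h2
  have hrank : Module.finrank ℂ U ≤ Fintype.card D := by
    have := LinearMap.finrank_le_finrank_of_injective hR
    rwa [Module.finrank_fintype_fun_eq_card] at this
  let v := stdOrthonormalBasis ℂ U
  have hsum : ∀ i, ‖K.starProjection (b i)‖ ^ 2 = ∑ k, ‖inner ℂ (b i) (v k : W)‖ ^ 2 := by
    intro i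
    have hmem : K.starProjection (b i) ∈ U := Submodule.subset_span ⟨i, rfl⟩
    have := v.sum_sq_norm_inner_right ⟨_, hmem⟩
    rw [Submodule.coe_norm] at this
    rw [← this]
    refine Finset.sum_congr rfl fun k _ => ?_
    rw [Submodule.coe_inner, hinner i _ (hUK (v k).2), norm_inner_symm]
  simp_rw [hsum]
  rw [Finset.sum_comm]
  -- After the sums are exchanged, Bessel bounds each basis vector of `U` by `1`, leaving the
  -- dimension of `U`.
  calc ∑ k, ∑ i, ‖inner ℂ (b i) (v k : W)‖ ^ 2 ≤ ∑ k : Fin (Module.finrank ℂ U), (1 : ℝ) := by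
        refine Finset.sum_le_sum fun k _ => (hb.sum_inner_products_le _).trans ?_
        rw [← Submodule.coe_norm, v.norm_eq_one]
        norm_num
    _ ≤ Fintype.card D := by
        simpa using hrank

/-- The vector `L p` is in `K` and its inner product with the projection of `L e` is `‖p‖ ^ 2`;
Cauchy–Schwarz concludes. -/
theorem norm_starProjection_le_of_isometry (K : Submodule ℂ W) [K.HasOrthogonalProjection]
    {L : W → W} (hL : ∀ a b, inner ℂ (L a) (L b) = inner ℂ a b) (hK : ∀ a ∈ K, L a ∈ K) (e : W) :
    ‖K.starProjection e‖ ≤ ‖K.starProjection (L e)‖ := by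
  set p := K.starProjection e with hp
  have hpK : p ∈ K := Submodule.starProjection_apply_mem _ _
  have hfix : ∀ ψ ∈ K, ∀ x, inner ℂ ψ (K.starProjection x) = inner ℂ ψ x := by
    intro ψ hψ x
    rw [← Submodule.inner_starProjection_left_eq_right, Submodule.starProjection_eq_self_iff.2 hψ]
  have hnorm : ∀ a, ‖L a‖ = ‖a‖ := by
    intro a
    have := hL a a
    rw [inner_self_eq_norm_sq_to_K, inner_self_eq_norm_sq_to_K] at this
    exact (sq_eq_sq₀ (norm_nonneg _) (norm_nonneg _)).1 (by exact_mod_cast this)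
  have h1 : inner ℂ (L p) (K.starProjection (L e)) = inner ℂ p p := by
    rw [hfix _ (hK p hpK), hL, ← hfix p hpK e]
  have h2 : ‖p‖ * ‖p‖ ≤ ‖p‖ * ‖K.starProjection (L e)‖ := by
    calc ‖p‖ * ‖p‖ = ‖inner ℂ p p‖ := by
          rw [inner_self_eq_norm_sq_to_K]; simp [pow_two]
      _ = ‖inner ℂ (L p) (K.starProjection (L e))‖ := by rw [h1]
      _ ≤ ‖L p‖ * _ := norm_inner_le_norm _ _
      _ = _ := by rw [hnorm]
  rcases (norm_nonneg p).eq_or_lt with h | h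
  · rw [← h]; exact norm_nonneg _
  · exact le_of_mul_le_mul_left h2 h

end Projection

/-! ### Absence of eigenvalues -/

section Eigenvectors

/-- A solution of the eigenvalue equations vanishes on a box if it vanishes on part of the
boundary. -/
theorem eq_zero_on_box {x y : ℤ × ℤ → ℂ} {z : ℂ} {p q : ℤ → ℂ} (hq : ∀ m, q m ≠ 0)
    (h1 : ∀ m n, y (m, n) + y (m - 1, n) + p m * y (m, n - 1) = z * x (m, n))
    (h2 : ∀ m n, x (m, n) + x (m + 1, n) + q m * x (m, n + 1) = z * y (m, n))
    (a b : ℤ) (N : ℕ) (hx0 : ∀ k : ℕ, k ≤ N → x (a + k, b) = 0)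
    (hy0 : ∀ k : ℕ, k ≤ N → y (a + k, b) = 0) (hyl : ∀ k : ℕ, k ≤ N → y (a, b + k) = 0)
    (hxr : ∀ k : ℕ, k ≤ N → x (a + N, b + k) = 0) (n : ℕ) (hn : n ≤ N) :
    ∀ m : ℕ, m ≤ N → x (a + m, b + n) = 0 ∧ y (a + m, b + n) = 0 := by
  induction n with
  | zero => exact fun m hm => by simpa using ⟨hx0 m hm, hy0 m hm⟩
  | succ n ih =>
    have ih := ih (by lia)
    have hx : ∀ m : ℕ, m ≤ N → x (a + m, b + (n + 1 : ℕ)) = 0 := by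
      intro m hm
      rcases hm.lt_or_eq with hlt | rfl
      -- The second equation gives `x` in the next row, except at the right end, which is
      -- prescribed; the first equation then gives `y` from left to right.
      · have h := h2 (a + m) (b + n)
        have e1 : a + m + 1 = a + (m + 1 : ℕ) := by push_cast; ring
        have e2 : b + n + 1 = b + (n + 1 : ℕ) := by push_cast; ring
        rw [e1, e2, (ih m hm).1, (ih m hm).2, (ih (m + 1) hlt).1] at h
        simpa [hq] using h
      · exact hxr _ hn
    intro m hm
    refine ⟨hx m hm, ?_⟩
    induction m with
    | zero => simpa using hyl _ hn
    | succ m ihm =>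
      have h := h1 (a + (m + 1 : ℕ)) (b + (n + 1 : ℕ))
      have e1 : a + (m + 1 : ℕ) - 1 = a + m := by push_cast; ring
      have e2 : b + (n + 1 : ℕ) - 1 = b + n := by push_cast; ring
      rw [e1, e2, hx _ hm, ihm (by lia), (ih _ hm).2] at h
      simpa using h

/-- The standard basis of `ℓ²(ℤ²) ⊕ ℓ²(ℤ²)`: `true` stands for the first summand. -/
noncomputable def site : Bool → ℤ × ℤ → WithLp 2 (Ell2 (ℤ × ℤ) × Ell2 (ℤ × ℤ))
  | true, γ => WithLp.toLp 2 (lp.single 2 γ 1, 0)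
  | false, γ => WithLp.toLp 2 (0, lp.single 2 γ 1)

theorem inner_site_true (γ : ℤ × ℤ) (ψ : WithLp 2 (Ell2 (ℤ × ℤ) × Ell2 (ℤ × ℤ))) :
    inner ℂ (site true γ) ψ = ψ.fst γ := by
  rw [site, WithLp.prod_inner_apply]
  simp [lp.inner_single_left]

theorem inner_site_false (γ : ℤ × ℤ) (ψ : WithLp 2 (Ell2 (ℤ × ℤ) × Ell2 (ℤ × ℤ))) :
    inner ℂ (site false γ) ψ = ψ.snd γ := by
  rw [site, WithLp.prod_inner_apply]
  simp [lp.inner_single_left]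

theorem orthonormal_site (s : Bool) : Orthonormal ℂ (site s) := by
  rw [orthonormal_iff_ite]
  intro γ γ'
  cases s
  · rw [inner_site_false]
    simp [site, lp.single_apply, Pi.single_apply]
  · rw [inner_site_true]
    simp [site, lp.single_apply, Pi.single_apply]

theorem inner_weightedShift {ι : Type} (σ : ι ≃ ι) (w : ι → ℂ) (C : ℝ) (hw : ∀ i, ‖w i‖ ≤ C)
    (hw1 : ∀ i, ‖w i‖ = 1) (u u' : Ell2 ι) :
    inner ℂ (weightedShift σ w C hw u) (weightedShift σ w C hw u') = inner ℂ u u' := by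
  rw [lp.inner_eq_tsum, lp.inner_eq_tsum, ← Equiv.tsum_eq σ (fun i => inner ℂ (u i) (u' i))]
  congr 1 with i
  rw [weightedShift_apply, weightedShift_apply, RCLike.inner_apply, RCLike.inner_apply, map_mul]
  have h : w i * conj (w i) = 1 := by
    rw [Complex.mul_conj, Complex.normSq_eq_norm_sq, hw1]; simp
  linear_combination (u' (σ i) * conj (u (σ i))) * h

theorem weightedShift_single {ι : Type} [DecidableEq ι] (σ : ι ≃ ι) (w : ι → ℂ) (C : ℝ)
    (hw : ∀ i, ‖w i‖ ≤ C) (i : ι) :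
    weightedShift σ w C hw (lp.single 2 (σ i) 1) = w i • lp.single 2 i 1 := by
  ext j
  rw [weightedShift_apply, lp.coeFn_smul, Pi.smul_apply, lp.single_apply, lp.single_apply,
    Pi.single_apply, Pi.single_apply, smul_eq_mul]
  by_cases h : j = i
  · simp [h]
  · simp [h, σ.injective.ne h]

variable {Φ : ℝ} {μ : ℂ}

theorem mem_eigenspace_Q_iff (ψ : WithLp 2 (Ell2 (ℤ × ℤ) × Ell2 (ℤ × ℤ))) :
    ψ ∈ Module.End.eigenspace (Q Φ).toLinearMap μ ↔ hop Φ ψ.snd = (3 * μ) • ψ.fst ∧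
      ContinuousLinearMap.adjoint (hop Φ) ψ.fst = (3 * μ) • ψ.snd := by
  rw [Module.End.mem_eigenspace_iff]
  have h1 : (Q Φ).toLinearMap ψ = (1 / 3 : ℂ) •
      WithLp.toLp 2 (hop Φ ψ.snd, ContinuousLinearMap.adjoint (hop Φ) ψ.fst) := rfl
  have h2 : μ • ψ = (1 / 3 : ℂ) • WithLp.toLp 2 ((3 * μ) • ψ.fst, (3 * μ) • ψ.snd) := by
    have h3 : ∀ u : Ell2 (ℤ × ℤ), μ • u = (1 / 3 : ℂ) • ((3 * μ) • u) := by
      intro u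
      rw [smul_smul]
      congr 1
      ring
    exact WithLp.ofLp_injective 2 (Prod.ext (h3 _) (h3 _))
  rw [h1, h2]
  constructor
  · intro h
    have h3 := smul_right_injective _ (by norm_num : (1 / 3 : ℂ) ≠ 0) h
    have h4 := Prod.ext_iff.1 (WithLp.toLp_injective 2 h3)
    exact h4
  · rintro ⟨h3, h4⟩
    rw [h3, h4]

instance : (Module.End.eigenspace (Q Φ).toLinearMap μ).HasOrthogonalProjection := by
  have hclosed : IsClosed
      (Module.End.eigenspace (Q Φ).toLinearMap μ : Set (WithLp 2 (Ell2 (ℤ × ℤ) × Ell2 (ℤ × ℤ)))) := by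
    have : (Module.End.eigenspace (Q Φ).toLinearMap μ :
        Set (WithLp 2 (Ell2 (ℤ × ℤ) × Ell2 (ℤ × ℤ)))) = {ψ | Q Φ ψ = μ • ψ} := by
      ext ψ
      exact Module.End.mem_eigenspace_iff
    rw [this]
    exact isClosed_eq (by fun_prop) (by fun_prop)
  have := hclosed.completeSpace_coe
  infer_instance

/-- Square norms of the projected basis vectors do not decrease under a weighted shift that
commutes with the hopping operator and its adjoint. -/
theorem norm_starProjection_site_le (σ : ℤ × ℤ ≃ ℤ × ℤ) (w : ℤ × ℤ → ℂ) (C : ℝ)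
    (hw : ∀ i, ‖w i‖ ≤ C) (hw1 : ∀ i, ‖w i‖ = 1)
    (hc : ∀ u, hop Φ (weightedShift σ w C hw u) = weightedShift σ w C hw (hop Φ u))
    (hc' : ∀ u, ContinuousLinearMap.adjoint (hop Φ) (weightedShift σ w C hw u) =
      weightedShift σ w C hw (ContinuousLinearMap.adjoint (hop Φ) u)) (s : Bool) (γ : ℤ × ℤ) :
    ‖(Module.End.eigenspace (Q Φ).toLinearMap μ).starProjection (site s (σ γ))‖ ≤
      ‖(Module.End.eigenspace (Q Φ).toLinearMap μ).starProjection (site s γ)‖ := by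
  set V := weightedShift σ w C hw with hV
  have h := norm_starProjection_le_of_isometry (Module.End.eigenspace (Q Φ).toLinearMap μ)
    (L := fun ψ => WithLp.toLp 2 (V ψ.fst, V ψ.snd))
    (fun a b => by
      rw [WithLp.prod_inner_apply, WithLp.prod_inner_apply]
      exact congrArg₂ _ (inner_weightedShift σ w C hw hw1 _ _)
        (inner_weightedShift σ w C hw hw1 _ _))
    (fun a ha => by
      rw [mem_eigenspace_Q_iff] at ha ⊢
      refine ⟨?_, ?_⟩
      · exact (hc _).trans (by rw [ha.1, map_smul]; rfl)
      · exact (hc' _).trans (by rw [ha.2, map_smul]; rfl))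
    (site s (σ γ))
  have hs : WithLp.toLp 2 (V (site s (σ γ)).fst, V (site s (σ γ)).snd) = w γ • site s γ := by
    cases s
    · rw [site, site, ← WithLp.toLp_smul]
      simp [hV, weightedShift_single]
    · rw [site, site, ← WithLp.toLp_smul]
      simp [hV, weightedShift_single]
  rw [hs, map_smul, norm_smul, hw1, one_mul] at h
  exact h

theorem norm_starProjection_site_add_le (s : Bool) (a b : ℤ) (m n : ℕ) :
    ‖(Module.End.eigenspace (Q Φ).toLinearMap μ).starProjection (site s (a, b))‖ ≤
      ‖(Module.End.eigenspace (Q Φ).toLinearMap μ).starProjection (site s (a + m, b + n))‖ := by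
  have hm : ∀ m : ℕ,
      ‖(Module.End.eigenspace (Q Φ).toLinearMap μ).starProjection (site s (a, b))‖ ≤
      ‖(Module.End.eigenspace (Q Φ).toLinearMap μ).starProjection (site s (a + m, b))‖ := by
    intro m
    induction m with
    | zero => simp
    | succ m ih =>
      have hexp : ∀ i j k l : ℂ, i + j = k + l →
          Complex.exp i * Complex.exp j = Complex.exp k * Complex.exp l := fun i j k l h => by
        rw [← Complex.exp_add, ← Complex.exp_add, h]
      -- A horizontal shift must carry the phase `exp (-iΦn)` in the other coordinate to commute
      -- with `τ₁`. The vertical shift needs no phase.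
      have h := norm_starProjection_site_le (Φ := Φ) (μ := μ) shiftFst
        (fun γ => Complex.exp (-Complex.I * Φ * γ.2)) 1 (fun γ => by simp [Complex.norm_exp])
        (fun γ => by simp [Complex.norm_exp])
        (fun u => by
          ext ⟨i, j⟩
          simp only [hop_apply, weightedShift_apply, shiftFst, Equiv.prodCongr_apply, Prod.map_apply,
            Equiv.subRight_apply, Equiv.refl_apply, mul_add]
          rw [← mul_assoc, ← mul_assoc, hexp]
          push_cast
          ring)
        (fun u => by
          ext ⟨i, j⟩
          simp only [hop_adjoint_apply, weightedShift_apply, shiftFst, Equiv.prodCongr_apply,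
            Prod.map_apply, Equiv.subRight_apply, Equiv.refl_apply, mul_add, add_sub_cancel_right,
            sub_add_cancel]
          rw [← mul_assoc, ← mul_assoc, hexp]
          push_cast
          ring)
        s (a + (m + 1 : ℕ), b)
      have e : shiftFst (a + (m + 1 : ℕ), b) = (a + m, b) := by
        simp [shiftFst]
        ring
      rw [e] at h
      exact ih.trans h
  refine (hm m).trans ?_
  induction n with
  | zero => simp
  | succ n ih =>
    have h := norm_starProjection_site_le (Φ := Φ) (μ := μ) shiftSnd
      (fun γ => 1) 1 (fun γ => by simp) (fun γ => by simp)
      (fun u => by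
        ext ⟨i, j⟩
        simp only [hop_apply, weightedShift_apply, shiftSnd, Equiv.prodCongr_apply, Prod.map_apply,
          Equiv.subRight_apply, Equiv.refl_apply, one_mul])
      (fun u => by
        ext ⟨i, j⟩
        simp only [hop_adjoint_apply, weightedShift_apply, shiftSnd, Equiv.prodCongr_apply,
          Prod.map_apply, Equiv.subRight_apply, Equiv.refl_apply, one_mul, add_sub_cancel_right,
          sub_add_cancel])
      s (a + m, b + (n + 1 : ℕ))
    have e : shiftSnd (a + m, b + (n + 1 : ℕ)) = (a + m, b + n) := by
      simp [shiftSnd]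
      ring
    rw [e] at h
    exact ih.trans h

/-- The norm at `(a, b)` bounds from below the norms at all `(N + 1) ^ 2` sites of a box with that
corner, whose squares sum to at most the number `4 * (N + 1)` of boundary data. Large `N` forces the
norm to vanish. -/
theorem starProjection_site_eq_zero (s : Bool) (γ : ℤ × ℤ) :
    (Module.End.eigenspace (Q Φ).toLinearMap μ).starProjection (site s γ) = 0 := by
  obtain ⟨a, b⟩ := γ
  set K := Module.End.eigenspace (Q Φ).toLinearMap μ with hK
  set r := ‖K.starProjection (site s (a, b))‖ with hr
  have key : ∀ N : ℕ, ((N : ℝ) + 1) ^ 2 * r ^ 2 ≤ ((N : ℝ) + 1) * 4 := by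
    intro N
    let pos : Fin (N + 1) × Fin (N + 1) → ℤ × ℤ := fun i => (a + (i.1 : ℕ), b + (i.2 : ℕ))
    have hpos : Function.Injective pos := by
      rintro ⟨i, j⟩ ⟨i', j'⟩ h
      simpa [pos, Fin.ext_iff] using h
    -- The boundary data are both components on the bottom row, the second on the left side and the
    -- first on the right side.
    let d : Fin (N + 1) × Fin 4 → WithLp 2 (Ell2 (ℤ × ℤ) × Ell2 (ℤ × ℤ)) := fun k =>
      ![site true (a + (k.1 : ℕ), b), site false (a + (k.1 : ℕ), b),
        site false (a, b + (k.1 : ℕ)), site true (a + N, b + (k.1 : ℕ))] k.2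
    have h := sum_norm_sq_starProjection_le K ((orthonormal_site s).comp pos hpos) d (by
      intro ψ hψ hd
      obtain ⟨e1, e2⟩ := (mem_eigenspace_Q_iff ψ).1 hψ
      have hbox := eq_zero_on_box (x := ψ.fst) (y := ψ.snd) (z := 3 * μ)
        (p := fun m => Complex.exp (-Complex.I * Φ * m))
        (q := fun m => Complex.exp (Complex.I * Φ * m)) (fun m => Complex.exp_ne_zero _)
        (fun m n => by rw [← hop_apply, e1]; rfl)
        (fun m n => by rw [← hop_adjoint_apply, e2]; rfl) a b N
        (fun k hk => by
          rw [← inner_site_true]; exact hd (⟨k, by lia⟩, 0))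
        (fun k hk => by
          rw [← inner_site_false]; exact hd (⟨k, by lia⟩, 1))
        (fun k hk => by
          rw [← inner_site_false]; exact hd (⟨k, by lia⟩, 2))
        (fun k hk => by
          rw [← inner_site_true]; exact hd (⟨k, by lia⟩, 3))
      rintro ⟨i, j⟩
      have hij := hbox j (by lia) i (by lia)
      cases s
      · exact (inner_site_false _ _).trans hij.2
      · exact (inner_site_true _ _).trans hij.1)
    calc ((N : ℝ) + 1) ^ 2 * r ^ 2 = ∑ i : Fin (N + 1) × Fin (N + 1), r ^ 2 := by
          rw [Finset.sum_const, Finset.card_univ, Fintype.card_prod, Fintype.card_fin,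
            nsmul_eq_mul]
          push_cast
          ring
      _ ≤ ∑ i : Fin (N + 1) × Fin (N + 1), ‖K.starProjection (site s (pos i))‖ ^ 2 := by
          refine Finset.sum_le_sum fun i _ => ?_
          have := norm_starProjection_site_add_le (Φ := Φ) (μ := μ) s a b i.1 i.2
          gcongr
      _ ≤ _ := h
      _ = _ := by simp
  by_contra hne
  have hr0 : 0 < r := norm_pos_iff.2 hne
  obtain ⟨N, hN⟩ := exists_nat_gt (4 / r ^ 2)
  rw [div_lt_iff₀ (by positivity)] at hN
  have h := key N
  rw [pow_two, mul_assoc] at h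
  have h' := le_of_mul_le_mul_left h (by positivity)
  nlinarith [sq_nonneg r]

theorem not_hasEigenvalue_Q (Φ : ℝ) (μ : ℂ) :
    ¬ Module.End.HasEigenvalue (Q Φ).toLinearMap μ := by
  intro h
  refine Module.End.hasEigenvalue_iff.1 h ((Submodule.eq_bot_iff _).2 fun ψ hψ => ?_)
  have h0 : ∀ s γ, inner ℂ (site s γ) ψ = 0 := by
    intro s γ
    rw [← Submodule.starProjection_eq_self_iff.2 hψ,
      ← Submodule.inner_starProjection_left_eq_right, starProjection_site_eq_zero, inner_zero_left]
  have h1 : ψ.fst = 0 := by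
    ext γ
    rw [← inner_site_true, h0]; rfl
  have h2 : ψ.snd = 0 := by
    ext γ
    rw [← inner_site_false, h0]; rfl
  exact WithLp.ofLp_injective 2 (Prod.ext h1 h2)

end Eigenvectors

end HexMagnetic

theorem mainTheorem11 (Φ : ℝ) :
    (HexMagnetic.unionSpectrum Φ ⊆ (fun E : ℝ => (E : ℂ)) '' Set.Ici (-3)) ∧
    (spectrum ℂ (HexMagnetic.Q Φ) =
      (fun x : ℝ => (x : ℂ)) ''
        ({x : ℝ | ∃ E : ℝ, (E : ℂ) ∈ HexMagnetic.unionSpectrum Φ ∧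
            (x = Real.sqrt (E / 9 + 1 / 3) ∨ x = -Real.sqrt (E / 9 + 1 / 3))} ∪ {0})) ∧
    (∀ μ : ℂ, ¬ Module.End.HasEigenvalue
      (HexMagnetic.Q Φ).toLinearMap μ) := by
  exact ⟨HexMagnetic.unionSpectrum_subset Φ, HexMagnetic.spectrum_Q Φ,
    HexMagnetic.not_hasEigenvalue_Q Φ⟩
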